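/- **Proposition.** For every integer $n\ge 1$, the geometric matrix $Q^K_{(2n+1)/1}$ of the rational torus knot $K_{(2n+1)/1}=T(2,2n+1)=\mathrm{Cl}(T\tau_{2n/1})$ is equal, entry by entry, to the matrix $Q_{(2n+1)/1}$ obtained by applying the Stošić–Wedrich closure operation $\mathrm{Cl}(T-)$ to the matrix $Q^T_{2n/1}$ of the rational tangle $\tau_{2n/1}$: $$Q^K_{(2n+1)/1}=Q_{(2n+1)/1}.$$ The objects are defined as follows. *Homomorphisms.* Let $M=\mathbb C\setminus\{X^+,X^-,Y\}$. Identify $\pi_1(\mathrm{Conf}^2(\mathbb C))\cong \mathrm{Br}_2\cong\mathbb Z$ so that a clockwise half turn of two points is $+1$. Let $\Phi:\pi_1(\mathrm{Conf}^2(M))\to\mathbb Z$ be induced by $M\subset\mathbb C$, and for $W\subseteq\{X^+,X^-,Y\}$ let $\Psi_W=\frac12\sum_{V\in W}\Psi^1_V:\pi_1(M)\to\mathbb Z$, where $\Psi^1_V(\gamma)$ is the value of the loop $(\gamma,V)$ in $\mathrm{Conf}^2(\mathbb C)$. *Tangle.* The tangle $\tau_{m/1}=T^m\tau_{0/1}$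 is built by $m$ top twists. The arc $\alpha_{2n/1}$ starts at $X^-$, makes $n$ clockwise turns around $Y$ and $X^-$, spiralling outwards, each starting below them, and then goes to $X^+$; the punctures lie on a horizontal line in the order $Y|X^-|X^+$. The vertical line $l_A$ between $Y$ and $X^-$ meets it in $2n$ (active) points, $n$ below and $n$ above the punctures, and the vertical line $l_I$ between $X^-$ and $X^+$ meets it in one (inactive) point $\xi_\omega$. For intersection points $\xi_i,\xi_j$, the loop $\gamma_{i,j}$ in $M$ goes from $\xi_i$ to $\xi_j$ along $\alpha$ and returns along their common axis if there is one, and otherwise along the axis of $\xi_j$ to its top point, along $\alpha$ to the top point of the other axis, and along that axis to $\xi_i$. Put $\gamma_i=\gamma_{i,\omega}$. For $i\ne j$ the loop $\gamma_{i,j}$ in $\mathrm{Conf}^2(M)$ is based at $\xi_i,\xi_j$ placed on two parallel copies of the axes: the lower point, or the active point if exactly one of them is active, is on the left copy. The first point moves from $\xi_i$ along $\alpha$ until it reaches $\xi_j$ on its own copy and returns as above while the second point stays fixed; but if it meets the second point at $\xi_j$ first, it stops there, and the second point continues in the same direction along $\alpha$ to $\xi_j$ on the copy of $\xi_i$ and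 returns from there to the starting position of the first point. The quadratic form of the tangle is $$Q_{ii}=(\Psi_{\{X^-,Y\}}-3\Psi_{X^+})([\gamma_i])+2\delta_{Z,X^+}(\delta_{i,I}\delta_{\omega,A}-\delta_{i,A}\delta_{\omega,I}),$$ $$Q_{ij}=Q_{ii}+(\Phi-2\Psi_{X^+})([\gamma_{j,i}])+\delta_{Z,X^+}(\delta_{i,A}\delta_{j,I}-\delta_{j,A}\delta_{i,I})\quad(i\ne j),$$ where $Z$ is the middle puncture (here $X^-$) and $\delta_{i,A}$ (resp. $\delta_{i,I}$) is $1$ if $\xi_i$ is active (resp. inactive) and $0$ otherwise. $Q^T_{2n/1}$ is the $(n+1)\times(n+1)$ matrix of its restriction to the $n$ upper active points, ordered along $\alpha$ from $X^-$ to $X^+$, followed by $\xi_\omega$. *Closure.* For $Q^T_{2n/1}=\begin{pmatrix}Q_{++}&Q_{+-}\\Q_{-+}&Q_{--}\end{pmatrix}$ with blocks of sizes $n$ and $1$, $$Q_{(2n+1)/1}=\begin{pmatrix}Q_{++}+2&Q_{++}+L&Q_{+-}\\Q_{++}+U&Q_{++}-1&Q_{+-}-1\\Q_{-+}&Q_{-+}-1&Q_{--}\end{pmatrix},$$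 where numbers are added to every entry of a block and $L$ (resp. $U$) has entries $1$ strictly below (resp. above) the diagonal and $0$ elsewhere. *Knot.* The arc $\alpha_{(2n+1)/1}$ starts at $X^-$ and spirals clockwise outwards around $X^-$ and $Y$, each turn starting above them, and after $n$ turns passes above them once more and ends at $X^+$; the punctures lie on a horizontal line in the order $X^-|Y|X^+$. Let $\overline{\alpha}$ be the boundary of a thin band around it and $\beta$ the horizontal segment from $Y$ to $X^+$. They meet in $2n+1$ points: two, on the inner and the outer strand of the band, for each of the $n$ interior crossings of $\alpha_{(2n+1)/1}$ with $\beta$, and one point $\kappa_\omega$ next to $X^+$. The standard ordering $\kappa_1,\dots,\kappa_{2n+1}$ consists of the $n$ points on the inner strand, then the $n$ points on the outer strand, both in the order of the crossings along $\alpha_{(2n+1)/1}$ from $X^-$, then $\kappa_\omega$. The loop $\gamma_{i,j}$ in $M$ goes from $\kappa_i$ to $\kappa_j$ along $\overline\alpha$, avoiding its end around $X^-$, and back along $\beta$; $\gamma_i=\gamma_{i,\omega}$. The loop $\gamma_{i,j}$ in $\mathrm{Conf}^2(M)$ is defined as for the tangle, with $\overline\alpha$ (avoiding its end around $X^-$)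 in place of $\alpha$ and two parallel copies of $\beta$ in place of the copies of the axes, the left one of $\kappa_i,\kappa_j$ being placed on the upper copy. Then $Q^K_{(2n+1)/1}$ is the matrix with $$Q_{ii}=(\Psi_{\{X^-,Y\}}-3\Psi_{X^+})([\gamma_i])+\mu_3,\qquad Q_{ij}=Q_{ii}+(\Phi-2\Psi_{X^+})([\gamma_{j,i}])\quad(i\neq j),$$ where $\mu_3=\#\{RUP,ROP^-\}-\#\{TOP^+,TRI,RRI\}$ counts, by type (top twist $T$ or right twist $R$, applied to a tangle of orientation $UP$, $OP$ or $RI$; $OP^{+}$ resp. $OP^-$ means $OP$ with fraction $>1$ resp. $<1$), the twists used to build $\tau_{2n/1}$. -/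

import Mathlib

namespace TorusKnotQuiver

/-! ### Braid exponents of loops in the plane -/

/-- The piecewise linear path through the listed points, parametrised by `[0, 1]`. -/
noncomputable def polyPath {E : Type*} [AddCommGroup E] [Module ℝ E] : List E → ℝ → E
  | [], _ => 0
  | [a], _ => a
  | a :: b :: l, t =>
      if t ≤ 1 / 2 then a + (2 * t) • (b - a) else polyPath (b :: l) (2 * t - 1)

/-- `IsBraidExponent c m`: the motion `c = (z₁, z₂) : [0, 1] → ℂ × ℂ` of two distinct points has
exponent `m`, i.e. `z₁ - z₂` sweeps the total angle `-m π`. For a loop in the unordered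
configuration space `Conf²(ℂ)` this is the image of its class under
`π₁(Conf²(ℂ)) ≅ Br₂ ≅ ℤ`, the isomorphism being normalised so that a clockwise half turn of the
two points is `+1`. -/
def IsBraidExponent (c : ℝ → ℂ × ℂ) (m : ℤ) : Prop :=
  ∃ θ : ℝ → ℝ, ContinuousOn θ (Set.Icc 0 1) ∧
    (∀ t ∈ Set.Icc (0 : ℝ) 1, (c t).1 ≠ (c t).2 ∧
      (c t).1 - (c t).2 = (‖(c t).1 - (c t).2‖ : ℂ) * Complex.exp ((θ t : ℂ) * Complex.I)) ∧
    θ 1 - θ 0 = -((m : ℝ) * Real.pi)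

/-- The braid exponent of a loop in `Conf²(ℂ)` (it is unique for such a loop). -/
noncomputable def braidExponent (c : ℝ → ℂ × ℂ) : ℤ :=
  Classical.epsilon (IsBraidExponent c)

/-- The names of the three punctures `X⁺, X⁻, Y`; `M` is the plane without them. -/
inductive Puncture
  | Xp
  | Xm
  | Y
  deriving DecidableEq

/-- `Ψ_W = (1/2) ∑_{V ∈ W} Ψ_V¹` on a polygonal loop in `M`, where `Ψ_V¹(γ)` is the braid exponent
of the motion `(γ, V)` (always even, so the division is exact). -/
noncomputable def Psi (pt : Puncture → ℂ) (W : Finset Puncture) (γ : List ℂ) : ℤ :=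
  (∑ V ∈ W, braidExponent (fun t => (polyPath γ t, pt V))) / 2

/-- `Φ` on a polygonal loop in `Conf²(M)`, given by a list of successive positions of the pair. -/
noncomputable def Phi (γ : List (ℂ × ℂ)) : ℤ :=
  braidExponent (polyPath γ)

/-! ### Pictures consisting of an arc crossing transverse Lagrangians, and their loops -/

/-- The transverse Lagrangian (`middle`) and its two parallel copies. For verticals, `one` is the
left copy and `two` the right copy; for the horizontal `β`, `one` is the top copy `β₁` and `two`
the bottom copy `β₂`. -/
inductive Track
  | one
  | middle
  | two

/-- Position of a copy when one crosses the copies in the order `one, middle, two`. -/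
def Track.offset : Track → ℕ
  | one => 0
  | middle => 1
  | two => 2

/-- The other parallel copy. -/
def Track.opp : Track → Track
  | one => two
  | middle => middle
  | two => one

/-- A picture with intersection points indexed by `ι`.
* `arc` lists the vertices, in order, of the polygonal arc along which all loops move;
* `pos i c` is the index of the vertex in which the arc meets copy `c` of the transverse
  Lagrangian at the intersection point `i`;
* `back c i j` lists the vertices of the return path from `j` to `i` on copy `c`;
* `place i j` is the copy on which `i` is placed in the base point of the loop in `Conf²(M)`
  attached to `(i, j)`; the point `j` is placed on the other copy;
* `omega` is the distinguished intersection point next to `X⁺`. -/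
structure Picture (ι : Type) where
  puncture : Puncture → ℂ
  arc : ℕ → ℂ
  pos : ι → Track → ℕ
  back : Track → ι → ι → List ℂ
  place : ι → ι → Track
  omega : ι

namespace Picture

variable {ι : Type} (P : Picture ι)

/-- The vertices met when one travels along the arc from the vertex `p` to the vertex `q`. -/
def along (p q : ℕ) : List ℂ :=
  if p ≤ q then (List.range' p (q - p + 1)).map P.arc
  else ((List.range' q (p - q + 1)).map P.arc).reverse

/-- The loop `γ_{i,j}` in `M`: along the arc from `i` to `j`, then back to `i` along the
transverse Lagrangian. -/
def loop (i j : ι) : List ℂ :=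
  P.along (P.pos i .middle) (P.pos j .middle) ++ P.back .middle i j

/-- The loop `γ̃_{i,j}` in `Conf²(M)`. The base point is `(A, B)`, with `A` the point `i` on its copy
and `B` the point `j` on the other copy; `C` is the point `j` on the copy of `i`. The first point
moves along the arc from `A` towards `C`.
* If it does not meet `B` before `C`, it returns from `C` to `A` along its copy, and the second
  point stays at `B`.
* If it meets `B` before `C`, it stops at `B`, and the second point continues along the arc
  from `B` to `C` and then along the copy of `i` to `A`. (The second point first makes room by
  moving from `B` to `C`, so that the two points never collide.) -/
noncomputable def pairLoop (i j : ι) : List (ℂ × ℂ) :=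
  let s := P.place i j
  let a := P.pos i s
  let b := P.pos j s.opp
  let c := P.pos j s
  let A := P.arc a
  let B := P.arc b
  let C := P.arc c
  if (a < b ∧ b < c) ∨ (c < b ∧ b < a) then
    (P.along b c).map (fun z => (A, z)) ++ (P.along a b).map (fun z => (z, C)) ++
      (P.back s i j).map (fun z => (B, z))
  else
    (P.along a c ++ P.back s i j).map (fun z => (z, B))

/-- `Ψ_W([γ_{i,j}])`. -/
noncomputable def psi (W : Finset Puncture) (i j : ι) : ℤ :=
  Psi P.puncture W (P.loop i j)

/-- `Φ([γ̃_{i,j}])`. -/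
noncomputable def phi (i j : ι) : ℤ :=
  Phi (P.pairLoop i j)

/-- `(Ψ_{X⁻,Y} - 3 Ψ_{X⁺})([γ_i])`, where `γ_i = γ_{i,ω}`. -/
noncomputable def diagTerm (i : ι) : ℤ :=
  P.psi {.Xm, .Y} i P.omega - 3 * P.psi {.Xp} i P.omega

/-- `(Φ - 2 Ψ_{X⁺})([γ_{j,i}])`. -/
noncomputable def offDiagTerm (i j : ι) : ℤ :=
  P.phi j i - 2 * P.psi {.Xp} j i

end Picture

/-! ### Twists, states of rational tangles, correction terms -/

/-- Top and right twists. -/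
inductive Twist
  | T
  | R

/-- Boundary orientations of rational tangles. -/
inductive Orientation
  | UP
  | OP
  | RI

/-- The state of the rational tangle `τ_{num/den}`: its orientation and the order
`left | mid | right` of the three punctures. -/
structure TangleState where
  ori : Orientation
  left : Puncture
  mid : Puncture
  right : Puncture
  num : ℕ
  den : ℕ

/-- The state of the trivial tangle `τ_{0/1}`. -/
def TangleState.trivial : TangleState :=
  ⟨.UP, .Y, .Xm, .Xp, 0, 1⟩

/-- The effect of a twist: `T` sends `u/v` to `(u+v)/v` and exchanges the two left punctures, `R`
sends `u/v` to `u/(u+v)` and exchanges the two right punctures. -/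
def TangleState.twist (s : TangleState) : Twist → TangleState
  | .T => ⟨match s.ori with
            | .UP => .UP
            | .OP => .RI
            | .RI => .OP,
          s.mid, s.left, s.right, s.num + s.den, s.den⟩
  | .R => ⟨match s.ori with
            | .UP => .OP
            | .OP => .UP
            | .RI => .RI,
          s.left, s.right, s.mid, s.num, s.num + s.den⟩

/-- The state reached from `s` by a sequence of twists (first twist first). -/
def TangleState.run (s : TangleState) (w : List Twist) : TangleState :=
  w.foldl TangleState.twist s

/-- Contribution of one twist, applied in state `s`, to
`#{RUP, ROP⁻} - #{TOP⁺, TRI, RRI}`, where `OP⁺` means `OP` with `u > v` and `OP⁻` means `OP` with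
`u < v`. -/
def TangleState.mu3Step (s : TangleState) : Twist → ℤ
  | .T => match s.ori with
    | .UP => 0
    | .OP => if s.den < s.num then -1 else 0
    | .RI => -1
  | .R => match s.ori with
    | .UP => 1
    | .OP => if s.num < s.den then 1 else 0
    | .RI => -1

/-- `#{RUP, ROP⁻} - #{TOP⁺, TRI, RRI}` for a sequence of twists applied in state `s`. -/
def TangleState.mu3 (s : TangleState) : List Twist → ℤ
  | [] => 0
  | t :: w => s.mu3Step t + (s.twist t).mu3 w

/-- The twists that build `τ_{2n/1} = T^{2n} τ_{0/1}`. -/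
def evenTwists (n : ℕ) : List Twist :=
  List.replicate (2 * n) .T

/-! ### The tangle `τ_{2n/1}` -/

/-- The `2n + 1` intersection points of `α_{2n/1}` with the axes: the arc crosses `l_A` `n` times
below and `n` times above the punctures `Y, X⁻` (numbered from the inside out, which is the order
along `α` from `X⁻` to `X⁺`), and crosses `l_I` once. -/
inductive TanglePoint (n : ℕ)
  | bottom (k : Fin n)
  | top (k : Fin n)
  | inactive

/-- Whether an intersection point is active. -/
def TanglePoint.isActive {n : ℕ} : TanglePoint n → Bool
  | bottom _ => true
  | top _ => true
  | inactive => false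

/-- The punctures of the tangle picture, in the order `Y | X⁻ | X⁺`. -/
def tanglePuncture (n : ℕ) : Puncture → ℂ
  | .Y => ⟨-2, 0⟩
  | .Xm => ⟨2, 0⟩
  | .Xp => ⟨n + 6, 0⟩

/-- The vertices of the arc `α_{2n/1}` oriented from `X⁻` to `X⁺` (the two ends `(2, 0) = X⁻`
before the first vertex, and `(n + 6, n)`, `(n + 6, 0) = X⁺` after the last one, are not needed).
It starts at `X⁻` and makes `n` clockwise turns around `Y` and `X⁻`: the `(k+1)`-st turn passes
below, to the left of and above these two punctures; finally the arc goes right to `X⁺`.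
The axes are `l_A = {x = 0}`, with copies `{x = -1}`, `{x = 1}`, and `l_I = {x = n + 4}`, with
copies `{x = n + 3}`, `{x = n + 5}`. -/
noncomputable def tangleArc (n t : ℕ) : ℂ :=
  if t < 10 * n then
    let m : ℝ := (t / 10 : ℕ) + 1
    match t % 10 with
    | 0 => ⟨m + 1, -m⟩
    | 1 => ⟨1, -m⟩
    | 2 => ⟨0, -m⟩
    | 3 => ⟨-1, -m⟩
    | 4 => ⟨-(m + 2), -m⟩
    | 5 => ⟨-(m + 2), m⟩
    | 6 => ⟨-1, m⟩
    | 7 => ⟨0, m⟩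
    | 8 => ⟨1, m⟩
    | _ => ⟨m + 2, m⟩
  else ⟨n + 3 + (t - 10 * n : ℕ), n⟩

/-- The index of the vertex in which the arc meets a copy of the axis through a point. -/
def tanglePos (n : ℕ) : TanglePoint n → Track → ℕ
  | .bottom k, c => 10 * k + 3 - c.offset
  | .top k, c => 10 * k + 6 + c.offset
  | .inactive, c => 10 * n + c.offset

/-- The index of the vertex in which the arc meets a copy of `l_A` for the last time; this is the
top intersection point on `l_A` (for `n ≥ 1`). -/
def tangleTopPos (n : ℕ) (c : Track) : ℕ :=
  10 * (n - 1) + 6 + c.offset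

/-- The part of `α` between the top intersection points on `l_A` and `l_I`, from `l_A` to `l_I`. -/
noncomputable def tangleSlide (n : ℕ) (c : Track) : List ℂ :=
  (List.range' (tangleTopPos n c) (10 * n + c.offset - tangleTopPos n c + 1)).map (tangleArc n)

/-- The return path from `j` to `i`: straight along the axis if both points lie on the same axis;
otherwise along the axis of `j` to its top point, along `α` to the top point of the other axis,
and along that axis to `i`. (On `l_I` the top point is the only intersection point.) -/
noncomputable def tangleBack (n : ℕ) (c : Track) (i j : TanglePoint n) : List ℂ :=
  [tangleArc n (tanglePos n j c)] ++
    (match i.isActive, j.isActive with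
      | true, false => (tangleSlide n c).reverse
      | false, true => tangleSlide n c
      | _, _ => []) ++
    [tangleArc n (tanglePos n i c)]

/-- The picture `𝒟(τ_{2n/1})`. In the base point for `(i, j)`, the lower point (if both points lie on
the same axis) or the active point (otherwise) is placed on the left copy. -/
noncomputable def tanglePicture (n : ℕ) : Picture (TanglePoint n) where
  puncture := tanglePuncture n
  arc := tangleArc n
  pos := tanglePos n
  back := tangleBack n
  place i j :=
    if i.isActive = j.isActive then
      if (tangleArc n (tanglePos n i .middle)).im < (tangleArc n (tanglePos n j .middle)).im
      then .one else .two
    else if i.isActive then .one else .two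
  omega := .inactive

/-- `δ_{i,A} δ_{j,I} - δ_{j,A} δ_{i,I}`. -/
def axisSign {n : ℕ} (i j : TanglePoint n) : ℤ :=
  match i.isActive, j.isActive with
  | true, false => 1
  | false, true => -1
  | _, _ => 0

/-- `δ_{Z,X⁺}` for `τ_{2n/1}`, where `Z` is the middle puncture of its state. -/
def tangleDeltaZ (n : ℕ) : ℤ :=
  if (TangleState.trivial.run (evenTwists n)).mid = Puncture.Xp then 1 else 0

/-- The quadratic form of `τ_{2n/1}` on all intersection points:
`Q_ii = (Ψ_{X⁻,Y} - 3Ψ_{X⁺})([γ_i]) + 2δ_{Z,X⁺}(δ_{i,I}δ_{ω,A} - δ_{i,A}δ_{ω,I})` and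
`Q_ij = Q_ii + (Φ - 2Ψ_{X⁺})([γ_{j,i}]) + δ_{Z,X⁺}(δ_{i,A}δ_{j,I} - δ_{j,A}δ_{i,I})`. -/
noncomputable def tangleForm (n : ℕ) (i j : TanglePoint n) : ℤ :=
  let P := tanglePicture n
  let d := P.diagTerm i - 2 * tangleDeltaZ n * axisSign i P.omega
  open Classical in
  if i = j then d else d + P.offDiagTerm i j + tangleDeltaZ n * axisSign i j

/-- The ordered basis `𝔜 ⊔ ℨ`. The arcs of `α` to the left of `l_A` join `bottom k` to `top k` around
`Y`; `𝔜` consists of the top points (in the order along `α`), `ℨ` of the inactive point. -/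
def tangleBasis (n : ℕ) : Fin n ⊕ Fin 1 → TanglePoint n
  | .inl k => .top k
  | .inr _ => .inactive

/-- The matrix `Q^T_{2n/1}`, with respect to the ordered basis `𝔜 ⊔ ℨ`. -/
noncomputable def QTangle (n : ℕ) : Matrix (Fin n ⊕ Fin 1) (Fin n ⊕ Fin 1) ℤ :=
  Matrix.of fun i j => tangleForm n (tangleBasis n i) (tangleBasis n j)

/-! ### The closure operation `Cl(T-)` -/

/-- The matrix all of whose entries are `1`. -/
def ones (α β : Type) : Matrix α β ℤ :=
  Matrix.of fun _ _ => 1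

/-- The matrix `L` with `1` strictly below the diagonal and `0` elsewhere. -/
def strictLower (m : ℕ) : Matrix (Fin m) (Fin m) ℤ :=
  Matrix.of fun i j => if j < i then 1 else 0

/-- The effect of `Cl(T-)` on the quadratic form of a tangle with `UP` orientation. A number added to
a block is added to each of its entries, and `U` is the transpose of `L`. -/
def closureUP {m l : ℕ} (Q : Matrix (Fin m ⊕ Fin l) (Fin m ⊕ Fin l) ℤ) :
    Matrix ((Fin m ⊕ Fin m) ⊕ Fin l) ((Fin m ⊕ Fin m) ⊕ Fin l) ℤ :=
  Matrix.fromBlocks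
    (Matrix.fromBlocks
      (Q.toBlocks₁₁ + 2 • ones _ _) (Q.toBlocks₁₁ + strictLower m)
      (Q.toBlocks₁₁ + (strictLower m).transpose) (Q.toBlocks₁₁ - ones _ _))
    (Matrix.fromRows Q.toBlocks₁₂ (Q.toBlocks₁₂ - ones _ _))
    (Matrix.fromCols Q.toBlocks₂₁ (Q.toBlocks₂₁ - ones _ _))
    Q.toBlocks₂₂

/-- The matrix `Q_{(2n+1)/1}`, obtained by applying `Cl(T-)` to `Q^T_{2n/1}`. -/
noncomputable def QClosure (n : ℕ) :
    Matrix ((Fin n ⊕ Fin n) ⊕ Fin 1) ((Fin n ⊕ Fin n) ⊕ Fin 1) ℤ :=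
  closureUP (QTangle n)

/-! ### The knot `K_{(2n+1)/1}` -/

/-- The `2n + 1` intersection points of the band around `α_{(2n+1)/1}` with `β`. The arc
`α_{(2n+1)/1}` crosses `β` `n` times before it ends in `X⁺`; the `(k+1)`-st crossing (along the arc
from `X⁻` to `X⁺`) gives the points `inner k` and `outer k` on the two strands of the band, and
`last` is the intersection point next to `X⁺`. -/
inductive KnotPoint (n : ℕ)
  | inner (k : Fin n)
  | outer (k : Fin n)
  | last

/-- The punctures of the knot picture, in the order `X⁻ | Y | X⁺`. -/
def knotPuncture (n : ℕ) : Puncture → ℂ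
  | .Xm => ⟨-3, 0⟩
  | .Y => ⟨0, 0⟩
  | .Xp => ⟨3 * n + 3, 0⟩

/-- The vertices of one strand of the band around `α_{(2n+1)/1}`: the inner strand for `s = -1`, the
outer one for `s = 1`; the arc itself corresponds to `s = 0`. It spirals outwards and clockwise
around `X⁻` and `Y`. In the block `7k, …, 7k + 6` it comes from the left above the two punctures,
turns down and crosses `β₁ = {y = 1}`, `β = {y = 0}` and `β₂ = {y = -1}`, passes below the two
punctures and goes up to their left. -/
noncomputable def bandStrand (s : ℝ) (t : ℕ) : ℂ :=
  let m : ℝ := 3 * ((t / 7 : ℕ) + 1) + s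
  match t % 7 with
  | 0 => ⟨m, m⟩
  | 1 => ⟨m, 1⟩
  | 2 => ⟨m, 0⟩
  | 3 => ⟨m, -1⟩
  | 4 => ⟨m, -m⟩
  | 5 => ⟨-(m + 3), -m⟩
  | _ => ⟨-(m + 3), m + 3⟩

/-- The vertices of the band around `α_{(2n+1)/1}`, cut at its end around `X⁻`: outwards along the
inner strand, around `X⁺ = (3n + 3, 0)` from its left to its right side through `(3n + 3, -2)`, and
back inwards along the outer strand. (The omitted part runs from the last vertex `(4, 4)` through
`(-4, 4)`, `(-4, -1)`, `(-2, -1)`, `(-2, 2)` to the first vertex `(2, 2)`; no loop may pass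
through it.) -/
noncomputable def bandArc (n t : ℕ) : ℂ :=
  if t ≤ 7 * n + 3 then bandStrand (-1) t
  else if t = 7 * n + 4 then ⟨3 * n + 3, -2⟩
  else bandStrand 1 (14 * n + 8 - t)

/-- The index of the vertex in which the band meets a copy of `β` at an intersection point. -/
def knotPos (n : ℕ) : KnotPoint n → Track → ℕ
  | .inner k, c => 7 * k + 1 + c.offset
  | .outer k, c => 14 * n + 8 - (7 * k + 1 + c.offset)
  | .last, c => 7 * n + 1 + c.offset

/-- The picture `𝒟(K_{(2n+1)/1})`, where `β` is the horizontal segment from `Y` to `X⁺`. The return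
path is the segment from `j` to `i` on the copy of `β`. In the base point for `(i, j)`, the point
further to the left is placed on the top copy `β₁`. -/
noncomputable def knotPicture (n : ℕ) : Picture (KnotPoint n) where
  puncture := knotPuncture n
  arc := bandArc n
  pos := knotPos n
  back c i j := [bandArc n (knotPos n j c), bandArc n (knotPos n i c)]
  place i j :=
    if (bandArc n (knotPos n i .middle)).re < (bandArc n (knotPos n j .middle)).re
    then .one else .two
  omega := .last

/-- The correction term `μ₃(K_{(2n+1)/1})`; it counts the twists used to build `τ_{2n/1}`, where
`K_{(2n+1)/1} = Cl(T τ_{2n/1})`. -/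
def knotMu3 (n : ℕ) : ℤ :=
  TangleState.trivial.mu3 (evenTwists n)

/-- The quadratic form of `K_{(2n+1)/1}` on its intersection points:
`Q_ii = (Ψ_{X⁻,Y} - 3Ψ_{X⁺})([γ_i]) + μ₃` and `Q_ij = Q_ii + (Φ - 2Ψ_{X⁺})([γ_{j,i}])`. -/
noncomputable def knotForm (n : ℕ) (i j : KnotPoint n) : ℤ :=
  let P := knotPicture n
  let d := P.diagTerm i + knotMu3 n
  open Classical in
  if i = j then d else d + P.offDiagTerm i j

/-- The standard ordering of the intersection points, in three blocks. Undoing the last top twist of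
`τ_{(2n+1)/1}` matches `inner k` with `top k`, `outer k` with `bottom k`, and `last` with
`inactive`; each block is ordered along `α_{2n/1}`. -/
def standardOrder (n : ℕ) : (Fin n ⊕ Fin n) ⊕ Fin 1 → KnotPoint n
  | .inl (.inl k) => .inner k
  | .inl (.inr k) => .outer k
  | .inr _ => .last

/-- The matrix `Q^K_{(2n+1)/1}`, with respect to the standard ordering. -/
noncomputable def QKnot (n : ℕ) :
    Matrix ((Fin n ⊕ Fin n) ⊕ Fin 1) ((Fin n ⊕ Fin n) ⊕ Fin 1) ℤ :=
  Matrix.of fun i j => knotForm n (standardOrder n i) (standardOrder n j)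

end TorusKnotQuiver

open Complex

namespace TorusKnotQuiver

/-! ### Uniqueness of the braid exponent -/

/-! Both matrices are computed in closed form and then compared. Number crossings from 0 outwards
along the spiral. The tangle form is `2 * (n - 1 - max k l)` on the upper active points and `0` as
soon as the inactive point is involved. In the knot, the last point behaves like crossing `n` of the
inner strand. The inner-inner entries are `2 * (n - max k l)`, the outer-outer entries are smaller
by 3, and the mixed entries are smaller by 2, or only by 1 when the crossing on the outer strand is
strictly the smaller one. These are the blocks of the closure.

The geometry behind the numbers: the loop of an upper tangle point winds `n - 1 - k` times clockwise
around `X⁻` and `Y`, that of a knot point `n - k` times, which gives the shift by 2. A loop from the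
outer strand to the last point also encircles `X⁺` once, which costs 3. Between two points of one
strand, `Φ` vanishes for outward travel and is -2 per turn for inward travel; this replaces an index
by the maximum. On the two strands of the band, the rule by which the moving point stops at the
other one produces the triangular terms `L` and `U`. All correction terms vanish.

Braid exponents are found by following the integral part of angle/π of the difference vector. Along
a segment on which one of two branches of the argument is continuous, its change can be read off
from the endpoints, and it does not depend on the chosen lift. Since the vector ends at plus or
minus its initial value, the total change is exactly the number of half turns
(`HalfTurns.isBraidExponent`). A level function `K` on the vertices of the arc with increments equal
to these changes makes the sum telescope (`Picture.braidExponent_loop`,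
`Picture.phi_eq_of_not_between`, `Picture.phi_eq_of_between`). Levels are supplied by
`tangle_edgeTurn_spiral` for the tangle and `band_edgeTurn` for the knot. -/

theorem eq_of_continuousOn_of_forall_int {g : ℝ → ℝ} (hg : ContinuousOn g (Set.Icc 0 1))
    (h : ∀ t ∈ Set.Icc (0 : ℝ) 1, ∃ k : ℤ, g t = k) : g 0 = g 1 := by
  have hd : DiscreteTopology (Set.range ((↑) : ℤ → ℝ)) :=
    Int.isClosedEmbedding_coe_real.isEmbedding.toHomeomorph.symm.isEmbedding.discreteTopology
  refine isPreconnected_Icc.constant_of_mapsTo (T := Set.range ((↑) : ℤ → ℝ)) ⟨hd⟩ hg ?_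
    (Set.left_mem_Icc.2 zero_le_one) (Set.right_mem_Icc.2 zero_le_one)
  intro t ht
  obtain ⟨k, hk⟩ := h t ht
  exact ⟨k, hk.symm⟩

/-- Two continuous angles of the same nonvanishing vector differ by an integer multiple of 2π, and
by continuity this integer is constant. Hence the choice made in `braidExponent` is harmless. -/
theorem IsBraidExponent.unique {c : ℝ → ℂ × ℂ} {m m' : ℤ} (h : IsBraidExponent c m)
    (h' : IsBraidExponent c m') : m = m' := by
  obtain ⟨θ, hθ, hc, hm⟩ := h
  obtain ⟨θ', hθ', hc', hm'⟩ := h'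
  have key := eq_of_continuousOn_of_forall_int (g := fun t => (θ t - θ' t) / (2 * Real.pi))
    ((hθ.sub hθ').div_const _) (fun t ht => by
      obtain ⟨hne, h1⟩ := hc t ht
      obtain ⟨-, h2⟩ := hc' t ht
      have hn : (‖(c t).1 - (c t).2‖ : ℂ) ≠ 0 := by
        simpa using sub_ne_zero.2 hne
      have h3 := mul_left_cancel₀ hn (h1.symm.trans h2)
      obtain ⟨k, hk⟩ := Complex.exp_eq_exp_iff_exists_int.1 h3
      refine ⟨k, ?_⟩
      have h4 : (θ t : ℂ) = ((θ' t + k * (2 * Real.pi) : ℝ) : ℂ) := by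
        apply mul_right_cancel₀ Complex.I_ne_zero
        rw [hk]; push_cast; ring
      have h5 : θ t = θ' t + k * (2 * Real.pi) := by exact_mod_cast h4
      rw [h5]
      field_simp
      ring)
  have hpi := Real.pi_pos
  have h6 : θ 0 - θ' 0 = θ 1 - θ' 1 := by
    field_simp at key
    linarith
  have h7 : (m : ℝ) * Real.pi = m' * Real.pi := by linarith
  exact_mod_cast mul_right_cancel₀ hpi.ne' h7

theorem IsBraidExponent.braidExponent_eq {c : ℝ → ℂ × ℂ} {m : ℤ} (h : IsBraidExponent c m) :
    braidExponent c = m :=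
  (Classical.epsilon_spec (p := IsBraidExponent c) ⟨m, h⟩).unique h

/-! ### Half turns of polygonal paths around the origin -/

/-- The segment from `a` to `b` avoids the origin and is visibly contained in the domain of a branch
of the argument; `d` is the change of the integral part of `arg / π` for this branch. -/
def ArgTurn (a b : ℂ) (d : ℤ) : Prop :=
  segment ℝ a b ⊆ slitPlane ∧ d = ⌊arg b / Real.pi⌋ - ⌊arg a / Real.pi⌋

/-- `ArgTurn` for one of the two branches of the argument that are cut along the real axis. -/
def HalfTurn (a b : ℂ) (d : ℤ) : Prop :=
  ArgTurn a b d ∨ ArgTurn (-a) (-b) d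

theorem ArgTurn.symm {a b : ℂ} {d : ℤ} (h : ArgTurn a b d) : ArgTurn b a (-d) :=
  ⟨segment_symm ℝ a b ▸ h.1, by rw [h.2]; ring⟩

theorem HalfTurn.symm {a b : ℂ} {d : ℤ} (h : HalfTurn a b d) : HalfTurn b a (-d) :=
  h.imp ArgTurn.symm ArgTurn.symm

theorem HalfTurn.left_ne_zero {a b : ℂ} {d : ℤ} (h : HalfTurn a b d) : a ≠ 0 := by
  rcases h with h | h
  · exact slitPlane_ne_zero (h.1 (left_mem_segment ℝ a b))
  · exact neg_ne_zero.1 (slitPlane_ne_zero (h.1 (left_mem_segment ℝ (-a) (-b))))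

/-- A nonzero number and its negative cannot both lie on the cut along the nonpositive reals.
Constant segments arise when vertex lists with a common endpoint are concatenated. -/
theorem halfTurn_self {a : ℂ} (h : a ≠ 0) : HalfTurn a a 0 := by
  by_cases ha : a ∈ slitPlane
  · exact .inl ⟨by simpa using ha, by simp⟩
  · refine .inr ⟨?_, by simp⟩
    have : -a ∈ slitPlane := by
      rw [mem_slitPlane_iff] at ha ⊢
      push Not at ha
      rcases ha.1.lt_or_eq with h1 | h1
      · left; simpa using h1
      · exact absurd (Complex.ext h1 ha.2) h
    simpa using this

theorem floor_add_two_pi_div_pi (x : ℝ) (j : ℤ) :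
    ⌊(x + j * (2 * Real.pi)) / Real.pi⌋ = ⌊x / Real.pi⌋ + 2 * j := by
  have : (x + j * (2 * Real.pi)) / Real.pi = x / Real.pi + ((2 * j : ℤ) : ℝ) := by
    have := Real.pi_ne_zero
    push_cast
    field_simp
  rw [this, Int.floor_add_intCast]

/-- `θ` is an angle of the non-zero complex number `z`. -/
def IsAngle (z : ℂ) (θ : ℝ) : Prop :=
  z ≠ 0 ∧ z = (‖z‖ : ℂ) * exp ((θ : ℂ) * I)

theorem IsAngle.neg {z : ℂ} {θ : ℝ} (h : IsAngle z θ) (k : ℤ) :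
    IsAngle (-z) (θ + (2 * k + 1) * Real.pi) := by
  refine ⟨neg_ne_zero.2 h.1, ?_⟩
  have h1 : (((θ + (2 * k + 1) * Real.pi : ℝ) : ℂ) * I) =
      (θ : ℂ) * I + k * (2 * Real.pi * I) + Real.pi * I := by
    push_cast; ring
  rw [h1, exp_add, exp_add, exp_int_mul_two_pi_mul_I, exp_pi_mul_I, norm_neg]
  conv_lhs => rw [h.2]
  ring

theorem isAngle_arg {z : ℂ} (h : z ≠ 0) : IsAngle z (arg z) :=
  ⟨h, (norm_mul_exp_arg_mul_I z).symm⟩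

theorem IsAngle.add_two_pi {z : ℂ} {θ : ℝ} (h : IsAngle z θ) (k : ℤ) :
    IsAngle z (θ + k * (2 * Real.pi)) := by
  refine ⟨h.1, ?_⟩
  have h1 : (((θ + k * (2 * Real.pi) : ℝ) : ℂ) * I) = (θ : ℂ) * I + k * (2 * Real.pi * I) := by
    push_cast; ring
  rw [h1, exp_add, exp_int_mul_two_pi_mul_I, mul_one]
  exact h.2

theorem IsAngle.exists_int {z : ℂ} {θ θ' : ℝ} (h : IsAngle z θ) (h' : IsAngle z θ') :
    ∃ k : ℤ, θ = θ' + k * (2 * Real.pi) := by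
  have hn : (‖z‖ : ℂ) ≠ 0 := by simpa using h.1
  obtain ⟨k, hk⟩ := Complex.exp_eq_exp_iff_exists_int.1
    (mul_left_cancel₀ hn (h.2.symm.trans h'.2))
  refine ⟨k, ?_⟩
  have h4 : (θ : ℂ) = ((θ' + k * (2 * Real.pi) : ℝ) : ℂ) := by
    apply mul_right_cancel₀ Complex.I_ne_zero
    rw [hk]; push_cast; ring
  exact_mod_cast h4

/-- On the slit plane `arg` is continuous, so the lift is `arg` plus a constant `2πj`. That constant
moves the floor by `2j` at both ends, so the increment is independent of the initial angle. -/
theorem ArgTurn.exists_lift {a b : ℂ} {d : ℤ} (h : ArgTurn a b d) {θ₀ : ℝ} (h₀ : IsAngle a θ₀) :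
    ∃ θ : ℝ → ℝ, Continuous θ ∧ θ 0 = θ₀ ∧
      (∀ t ∈ Set.Icc (0 : ℝ) 1, IsAngle (a + t • (b - a)) (θ t)) ∧
      ⌊θ 1 / Real.pi⌋ = ⌊θ₀ / Real.pi⌋ + d := by
  obtain ⟨hs, rfl⟩ := h
  obtain ⟨j, rfl⟩ := h₀.exists_int (isAngle_arg h₀.1)
  have hmem : ∀ t ∈ Set.Icc (0 : ℝ) 1, a + t • (b - a) ∈ slitPlane := fun t ht =>
    hs (by rw [segment_eq_image']; exact ⟨t, ht, rfl⟩)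
  have hcont : ContinuousOn (fun t : ℝ => arg (a + t • (b - a)) + j * (2 * Real.pi))
      (Set.Icc 0 1) := by
    refine ContinuousOn.add (fun t ht => ?_) continuousOn_const
    exact ((continuousAt_arg (hmem t ht)).comp (f := fun t : ℝ => a + t • (b - a))
      (by fun_prop)).continuousWithinAt
  -- Extending by constants outside the unit interval makes the lift continuous on all of ℝ, so that
  -- lifts of successive segments can be glued.
  refine ⟨Set.IccExtend zero_le_one ((Set.Icc (0 : ℝ) 1).domRestrict
    fun t : ℝ => arg (a + t • (b - a)) + j * (2 * Real.pi)),
    (continuousOn_iff_continuous_domRestrict.1 hcont).Icc_extend', ?_, fun t ht => ?_, ?_⟩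
  · rw [Set.IccExtend_left, Set.domRestrict_apply]
    simp
  · rw [Set.IccExtend_of_mem _ _ ht]
    exact (isAngle_arg (slitPlane_ne_zero (hmem t ht))).add_two_pi j
  · rw [Set.IccExtend_right, Set.domRestrict_apply]
    simp only [one_smul, add_sub_cancel]
    rw [floor_add_two_pi_div_pi, floor_add_two_pi_div_pi]
    ring

/-- For the second branch, negating the segment shifts every angle by π, hence the floor of angle/π
by 1 at both ends, and the increment survives. -/
theorem HalfTurn.exists_lift {a b : ℂ} {d : ℤ} (h : HalfTurn a b d) {θ₀ : ℝ} (h₀ : IsAngle a θ₀) :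
    ∃ θ : ℝ → ℝ, Continuous θ ∧ θ 0 = θ₀ ∧
      (∀ t ∈ Set.Icc (0 : ℝ) 1, IsAngle (a + t • (b - a)) (θ t)) ∧
      ⌊θ 1 / Real.pi⌋ = ⌊θ₀ / Real.pi⌋ + d := by
  rcases h with h | h
  · exact h.exists_lift h₀
  · obtain ⟨θ, hc, h0, ht, h1⟩ := h.exists_lift (h₀.neg 0)
    have key : ∀ x : ℝ, ⌊(x - Real.pi) / Real.pi⌋ = ⌊x / Real.pi⌋ - 1 := fun x => by
      rw [sub_div, div_self Real.pi_ne_zero, Int.floor_sub_one]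
    refine ⟨fun t => θ t - Real.pi, by fun_prop, by simp [h0], fun t htt => ?_, ?_⟩
    · have := (ht t htt).neg (-1)
      convert this using 1
      · simp only [real_smul]; ring
      · push_cast; ring
    · have h2 := key (θ₀ + (2 * (0 : ℤ) + 1) * Real.pi)
      rw [show θ₀ + (2 * ((0 : ℤ) : ℝ) + 1) * Real.pi - Real.pi = θ₀ by push_cast; ring] at h2
      simp only [key, h1, h2]
      ring

/-- The listed points are the vertices of a polygonal path from `a` to `b` in `ℂ \ {0}` whose
segments make `d` half turns (counterclockwise) in total. -/
inductive HalfTurns : ℂ → ℂ → List ℂ → ℤ → Prop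
  | single {a : ℂ} (h : a ≠ 0) : HalfTurns a a [a] 0
  | cons {a b c : ℂ} {l : List ℂ} {d e : ℤ} (h : HalfTurn a b d) (h' : HalfTurns b c l e) :
      HalfTurns a c (a :: l) (d + e)

theorem HalfTurns.left_ne_zero {a b : ℂ} {l : List ℂ} {d : ℤ} (h : HalfTurns a b l d) : a ≠ 0 := by
  cases h with
  | single h => exact h
  | cons h _ => exact h.left_ne_zero

theorem HalfTurns.append {a b c : ℂ} {l l' : List ℂ} {d e : ℤ} (h : HalfTurns a b l d)
    (h' : HalfTurns b c l' e) : HalfTurns a c (l ++ l') (d + e) := by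
  induction h with
  | single h => exact .cons (halfTurn_self h) h'
  | cons h _ ih => rw [add_assoc]; exact .cons h (ih h')

theorem HalfTurns.concat {a b c : ℂ} {l : List ℂ} {d e : ℤ} (h : HalfTurns a b l d)
    (h' : HalfTurn b c e) (hc : c ≠ 0) : HalfTurns a c (l ++ [c]) (d + e) := by
  induction h with
  | single h => rw [add_comm]; exact .cons h' (.single hc)
  | cons h _ ih => rw [add_assoc]; exact .cons h (ih h')

theorem HalfTurns.reverse {a b : ℂ} {l : List ℂ} {d : ℤ} (h : HalfTurns a b l d) :
    HalfTurns b a l.reverse (-d) := by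
  induction h with
  | single h => simpa using HalfTurns.single h
  | cons h _ ih =>
    rw [List.reverse_cons, neg_add_rev]
    exact ih.concat h.symm h.left_ne_zero

/-- The lift of the remaining path starts at the final angle of the first segment. So the two lifts
agree at time 1/2, where `polyPath` switches, and the floor increments add up. -/
theorem HalfTurns.exists_lift {a b : ℂ} {l : List ℂ} {d : ℤ} (h : HalfTurns a b l d) {θ₀ : ℝ}
    (h₀ : IsAngle a θ₀) :
    ∃ θ : ℝ → ℝ, Continuous θ ∧ θ 0 = θ₀ ∧
      (∀ t ∈ Set.Icc (0 : ℝ) 1, IsAngle (polyPath l t) (θ t)) ∧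
      ⌊θ 1 / Real.pi⌋ = ⌊θ₀ / Real.pi⌋ + d ∧ polyPath l 0 = a ∧ polyPath l 1 = b := by
  induction h generalizing θ₀ with
  | single h => exact ⟨fun _ => θ₀, continuous_const, rfl, fun _ _ => h₀, by simp, rfl, rfl⟩
  | @cons a b c l d e h h' ih =>
    obtain ⟨θ, hc, h0, ht, h1⟩ := h.exists_lift h₀
    have hb : IsAngle b (θ 1) := by simpa using ht 1 (by simp)
    obtain ⟨θ', hc', h0', ht', h1', hl0, hl1⟩ := ih hb
    obtain ⟨l', rfl⟩ : ∃ l', l = b :: l' := by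
      cases h' with
      | single _ => exact ⟨_, rfl⟩
      | cons _ _ => exact ⟨_, rfl⟩
    refine ⟨fun t => if t ≤ 1 / 2 then θ (2 * t) else θ' (2 * t - 1), ?_, ?_, ?_, ?_, ?_, ?_⟩
    · refine Continuous.if_le (by fun_prop) (by fun_prop) continuous_id continuous_const ?_
      rintro t rfl
      norm_num [h0']
    · norm_num [h0]
    · intro t htt
      simp only [polyPath]
      split_ifs with h2
      · exact ht (2 * t) ⟨by linarith [htt.1], by linarith⟩
      · exact ht' (2 * t - 1) ⟨by linarith, by linarith [htt.2]⟩
    · norm_num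
      rw [h1', h1]; ring
    · simp [polyPath]
    · norm_num [polyPath, hl1]

/-- Serves to pass from the motion of a pair, or of a point around a fixed centre, to the difference
vector. -/
theorem polyPath_map {E F : Type*} [AddCommGroup E] [Module ℝ E] [AddCommGroup F] [Module ℝ F]
    (f : E → F) (hf : ∀ (a b : E) (s : ℝ), f (a + s • (b - a)) = f a + s • (f b - f a)) :
    ∀ (l : List E) (_ : l ≠ []) (t : ℝ), polyPath (l.map f) t = f (polyPath l t)
  | [a], _, t => rfl
  | a :: b :: l, _, t => by
    have ih := polyPath_map f hf (b :: l) (by simp) (2 * t - 1)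
    simp only [List.map_cons, polyPath] at ih ⊢
    split_ifs
    · rw [hf]
    · exact ih

theorem HalfTurns.ne_nil {a b : ℂ} {l : List ℂ} {d : ℤ} (h : HalfTurns a b l d) : l ≠ [] := by
  cases h <;> simp

/-- In general the floor only approximates the angle. Here `b = a` or `b = -a` forces the total
angle to be `kπ` with `k` an integer, so the floor changes by exactly `k`. The sign appears because
clockwise half turns count as positive. -/
theorem HalfTurns.isBraidExponent {c : ℝ → ℂ × ℂ} {a b : ℂ} {l : List ℂ} {d : ℤ}
    (h : HalfTurns a b l d) (hab : b = a ∨ b = -a)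
    (hc : ∀ t, (c t).1 - (c t).2 = polyPath l t) : IsBraidExponent c (-d) := by
  obtain ⟨θ, hθ, h0, ht, h1, hl0, hl1⟩ := h.exists_lift (isAngle_arg h.left_ne_zero)
  refine ⟨θ, hθ.continuousOn, fun t htt => ?_, ?_⟩
  · obtain ⟨h2, h3⟩ := ht t htt
    rw [← hc] at h2 h3
    exact ⟨sub_ne_zero.1 h2, h3⟩
  · have e0 : IsAngle a (θ 0) := hl0 ▸ ht 0 (by simp)
    have e1 : IsAngle b (θ 1) := hl1 ▸ ht 1 (by simp)
    obtain ⟨k, hk⟩ : ∃ k : ℤ, θ 1 = θ 0 + k * Real.pi := by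
      rcases hab with rfl | rfl
      · obtain ⟨k, hk⟩ := e1.exists_int e0
        exact ⟨2 * k, by rw [hk]; push_cast; ring⟩
      · obtain ⟨k, hk⟩ := e1.exists_int (e0.neg 0)
        exact ⟨2 * k + 1, by rw [hk]; push_cast; ring⟩
    have hkd : k = d := by
      rw [← h0, hk, add_div, mul_div_assoc, div_self Real.pi_ne_zero, mul_one,
        Int.floor_add_intCast] at h1
      linarith
    rw [hk, hkd]
    push_cast
    ring

theorem HalfTurns.braidExponent_polyPath {a b : ℂ} {l : List (ℂ × ℂ)} {d : ℤ}
    (h : HalfTurns a b (l.map fun p => p.1 - p.2) d) (hab : b = a ∨ b = -a) :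
    braidExponent (polyPath l) = -d :=
  (h.isBraidExponent hab fun t => (polyPath_map (fun p : ℂ × ℂ => p.1 - p.2)
    (fun a b s => by simp; ring) l (by simpa using h.ne_nil) t).symm).braidExponent_eq

theorem HalfTurns.braidExponent_const {a b v : ℂ} {l : List ℂ} {d : ℤ}
    (h : HalfTurns a b (l.map fun z => z - v) d) (hab : b = a ∨ b = -a) :
    braidExponent (fun t => (polyPath l t, v)) = -d :=
  (h.isBraidExponent hab fun t => (polyPath_map (fun z : ℂ => z - v)
    (fun a b s => by simp; ring) l (by simpa using h.ne_nil) t).symm).braidExponent_eq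

theorem halfTurns_range' {f : ℕ → ℂ} {K : ℕ → ℤ} (p n : ℕ) (h : f (p + n) ≠ 0)
    (hf : ∀ t, p ≤ t → t < p + n → HalfTurn (f t) (f (t + 1)) (K (t + 1) - K t)) :
    HalfTurns (f p) (f (p + n)) ((List.range' p (n + 1)).map f) (K (p + n) - K p) := by
  induction n generalizing p with
  | zero => simpa using HalfTurns.single h
  | succ n ih =>
    rw [List.range'_succ, List.map_cons]
    have := HalfTurns.cons (hf p le_rfl (by omega))
      (ih (p + 1) (by convert h using 2; omega)
        fun t h1 h2 => hf t (by omega) (by omega))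
    convert this using 2
    · omega
    · rw [show p + 1 + n = p + (n + 1) by omega]; ring

/-! ### Points with integral coordinates -/

/-- The segment from `(x, y)` to `(x', y')` is contained in the upper or lower half plane, or crosses
the positive or negative real axis within the right or left half plane; it makes `d` half turns. -/
inductive LatticeTurn (x y x' y' d : ℤ) : Prop
  -- The half planes are half open: the positive real axis belongs to the upper one, the negative
  -- real axis to the lower one. This matches the floor of angle/π on [0, π) and [π, 2π), and fixes
  -- the strict and weak inequalities below.
  | upper (h : 0 < y ∨ y = 0 ∧ 0 < x) (h' : 0 < y' ∨ y' = 0 ∧ 0 < x') (hd : d = 0)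
  | lower (h : y < 0 ∨ y = 0 ∧ x < 0) (h' : y' < 0 ∨ y' = 0 ∧ x' < 0) (hd : d = 0)
  | rightDown (h : 0 < x ∧ 0 ≤ y) (h' : 0 < x' ∧ y' < 0) (hd : d = -1)
  | rightUp (h : 0 < x ∧ y < 0) (h' : 0 < x' ∧ 0 ≤ y') (hd : d = 1)
  | leftDown (h : x < 0 ∧ 0 < y) (h' : x' < 0 ∧ y' ≤ 0) (hd : d = 1)
  | leftUp (h : x < 0 ∧ y ≤ 0) (h' : x' < 0 ∧ 0 < y') (hd : d = -1)

theorem LatticeTurn.symm {x y x' y' d : ℤ} (h : LatticeTurn x y x' y' d) :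
    LatticeTurn x' y' x y (-d) := by
  cases h with
  | upper h h' hd => exact .upper h' h (by omega)
  | lower h h' hd => exact .lower h' h (by omega)
  | rightDown h h' hd => exact .rightUp h' h (by omega)
  | rightUp h h' hd => exact .rightDown h' h (by omega)
  | leftDown h h' hd => exact .leftUp h' h (by omega)
  | leftUp h h' hd => exact .leftDown h' h (by omega)

/-- The complex number with the given integral coordinates. -/
def latticePoint (x y : ℤ) : ℂ := ⟨x, y⟩

theorem latticePoint_sub (x y x' y' : ℤ) :
    latticePoint x y - latticePoint x' y' = latticePoint (x - x') (y - y') := by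
  apply Complex.ext <;> simp [latticePoint]

theorem neg_latticePoint (x y : ℤ) : -latticePoint x y = latticePoint (-x) (-y) := by
  apply Complex.ext <;> simp [latticePoint]

theorem floor_arg_div_pi_of_nonneg {z : ℂ} (h : 0 ≤ z.im) (hz : z ∈ slitPlane) :
    ⌊arg z / Real.pi⌋ = 0 := by
  rw [Int.floor_eq_zero_iff]
  have h1 := arg_nonneg_iff.2 h
  -- The slit plane excludes the angle π, for which the floor would be 1.
  have h2 := (arg_le_pi z).lt_of_ne (mem_slitPlane_iff_arg.1 hz).1
  exact ⟨div_nonneg h1 Real.pi_pos.le, (div_lt_one Real.pi_pos).2 h2⟩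

theorem floor_arg_div_pi_of_neg {z : ℂ} (h : z.im < 0) : ⌊arg z / Real.pi⌋ = -1 := by
  rw [Int.floor_eq_iff]
  have h1 := arg_neg_iff.2 h
  have h2 := (neg_pi_lt_arg z).le
  have := Real.pi_pos
  push_cast
  exact ⟨by rw [le_div_iff₀ this]; linarith, by rw [div_lt_iff₀ this]; linarith⟩

theorem segment_subset_slitPlane_of_re_pos {a b : ℂ} (ha : 0 < a.re) (hb : 0 < b.re) :
    segment ℝ a b ⊆ slitPlane := fun z hz => by
  have : z ∈ {z : ℂ | 0 < z.re} :=
    (convex_halfSpace_re_gt 0).segment_subset (x := a) (y := b) ha hb hz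
  exact mem_slitPlane_iff.2 (.inl this)

theorem segment_subset_slitPlane_of_upper {a b : ℂ} (ha : 0 < a.im ∨ a.im = 0 ∧ 0 < a.re)
    (hb : 0 < b.im ∨ b.im = 0 ∧ 0 < b.re) : segment ℝ a b ⊆ slitPlane := by
  rintro z ⟨s, t, hs, ht, hst, rfl⟩
  simp only [mem_slitPlane_iff, real_smul, add_re, add_im, re_ofReal_mul, im_ofReal_mul]
  rcases hs.eq_or_lt with rfl | hs
  · obtain rfl : t = 1 := by linarith
    rcases hb with hb | hb
    · right; simpa using hb.ne'
    · left; simpa using hb.2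
  rcases ht.eq_or_lt with rfl | ht
  · obtain rfl : s = 1 := by linarith
    rcases ha with ha | ha
    · right; simpa using ha.ne'
    · left; simpa using ha.2
  rcases ha with ha | ⟨ha, ha'⟩ <;> rcases hb with hb | ⟨hb, hb'⟩
  · right; positivity
  · right; rw [hb]; simp [hs.ne', ha.ne']
  · right; rw [ha]; simp [ht.ne', hb.ne']
  · left; positivity

theorem floor_arg_latticePoint {u v : ℤ} (h : latticePoint u v ∈ slitPlane) :
    ⌊arg (latticePoint u v) / Real.pi⌋ = if 0 ≤ v then 0 else -1 := by
  split_ifs with hv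
  · exact floor_arg_div_pi_of_nonneg (by simpa [latticePoint] using hv) h
  · exact floor_arg_div_pi_of_neg (by simpa [latticePoint] using hv)

theorem argTurn_latticePoint_of_right {x y x' y' : ℤ} (h : 0 < x) (h' : 0 < x') :
    ArgTurn (latticePoint x y) (latticePoint x' y')
      ((if 0 ≤ y' then 0 else -1) - (if 0 ≤ y then 0 else -1)) := by
  have hs : segment ℝ (latticePoint x y) (latticePoint x' y') ⊆ slitPlane :=
    segment_subset_slitPlane_of_re_pos (by simpa [latticePoint] using h)
      (by simpa [latticePoint] using h')
  exact ⟨hs, by rw [floor_arg_latticePoint (hs (left_mem_segment ℝ _ _)),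
    floor_arg_latticePoint (hs (right_mem_segment ℝ _ _))]⟩

theorem argTurn_latticePoint_of_upper {x y x' y' : ℤ} (h : 0 < y ∨ y = 0 ∧ 0 < x)
    (h' : 0 < y' ∨ y' = 0 ∧ 0 < x') : ArgTurn (latticePoint x y) (latticePoint x' y') 0 := by
  have hs : segment ℝ (latticePoint x y) (latticePoint x' y') ⊆ slitPlane :=
    segment_subset_slitPlane_of_upper (by simpa [latticePoint] using h)
      (by simpa [latticePoint] using h')
  refine ⟨hs, ?_⟩
  rw [floor_arg_latticePoint (hs (left_mem_segment ℝ _ _)),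
    floor_arg_latticePoint (hs (right_mem_segment ℝ _ _)), if_pos (by omega), if_pos (by omega)]
  rfl

theorem LatticeTurn.halfTurn {x y x' y' d : ℤ} (h : LatticeTurn x y x' y' d) :
    HalfTurn (latticePoint x y) (latticePoint x' y') d := by
  cases h with
  | upper h h' hd => exact .inl (hd ▸ argTurn_latticePoint_of_upper h h')
  | lower h h' hd =>
    refine .inr ?_
    rw [neg_latticePoint, neg_latticePoint, hd]
    exact argTurn_latticePoint_of_upper (by omega) (by omega)
  | rightDown h h' hd =>
    refine .inl ?_
    convert argTurn_latticePoint_of_right h.1 h'.1 using 1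
    rw [if_neg (by omega), if_pos (by omega), hd]; rfl
  | rightUp h h' hd =>
    refine .inl ?_
    convert argTurn_latticePoint_of_right h.1 h'.1 using 1
    rw [if_pos (by omega), if_neg (by omega), hd]; rfl
  | leftDown h h' hd =>
    refine .inr ?_
    rw [neg_latticePoint, neg_latticePoint]
    convert argTurn_latticePoint_of_right (neg_pos.2 h.1) (neg_pos.2 h'.1) using 1
    rw [if_pos (by omega), if_neg (by omega), hd]; rfl
  | leftUp h h' hd =>
    refine .inr ?_
    rw [neg_latticePoint, neg_latticePoint]
    convert argTurn_latticePoint_of_right (neg_pos.2 h.1) (neg_pos.2 h'.1) using 1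
    rw [if_neg (by omega), if_pos (by omega), hd]; rfl

theorem HalfTurn.neg {a b : ℂ} {d : ℤ} (h : HalfTurn a b d) : HalfTurn (-a) (-b) d :=
  h.elim (fun h => .inr (by simpa using h)) .inl

theorem HalfTurns.neg {a b : ℂ} {l : List ℂ} {d : ℤ} (h : HalfTurns a b l d) :
    HalfTurns (-a) (-b) (l.map fun z => -z) d := by
  induction h with
  | single h => exact .single (neg_ne_zero.2 h)
  | cons h _ ih => exact .cons h.neg ih

theorem latticePoint_ne_zero {x y : ℤ} (h : x ≠ 0 ∨ y ≠ 0) : latticePoint x y ≠ 0 := by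
  intro h0
  have h1 := congrArg Complex.re h0
  have h2 := congrArg Complex.im h0
  simp only [latticePoint, zero_re, zero_im, Int.cast_eq_zero] at h1 h2
  omega

theorem LatticeTurn.left_ne_zero {x y x' y' d : ℤ} (h : LatticeTurn x y x' y' d) :
    x ≠ 0 ∨ y ≠ 0 := by
  cases h <;> omega

theorem LatticeTurn.right_ne_zero {x y x' y' d : ℤ} (h : LatticeTurn x y x' y' d) :
    x' ≠ 0 ∨ y' ≠ 0 :=
  h.symm.left_ne_zero

theorem latticeTurn_of_upper {x y x' y' : ℤ} (h : 0 < y ∨ y = 0 ∧ 0 < x)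
    (h' : 0 < y' ∨ y' = 0 ∧ 0 < x') : LatticeTurn x y x' y' 0 :=
  .upper h h' rfl

theorem latticeTurn_of_lower {x y x' y' : ℤ} (h : y < 0 ∨ y = 0 ∧ x < 0)
    (h' : y' < 0 ∨ y' = 0 ∧ x' < 0) : LatticeTurn x y x' y' 0 :=
  .lower h h' rfl

/-- The edge from the vertex `t` to the vertex `t + 1` of the lattice path with coordinates `X`, `Y`
makes `K (t + 1) - K t` half turns around `(vx, vy)`. -/
def EdgeTurn (X Y : ℕ → ℤ) (vx vy : ℤ) (K : ℕ → ℤ) (t : ℕ) : Prop :=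
  LatticeTurn (X t - vx) (Y t - vy) (X (t + 1) - vx) (Y (t + 1) - vy) (K (t + 1) - K t)

/-! ### Braid exponents of the loops of a picture, from levels along its arc -/

namespace Picture

variable {ι : Type} {P : Picture ι} {X Y : ℕ → ℤ}

theorem along_reverse (p q : ℕ) : (P.along p q).reverse = P.along q p := by
  unfold along
  rcases lt_trichotomy p q with h | rfl | h
  · rw [if_pos h.le, if_neg (by omega)]
  · simp
  · rw [if_neg (by omega), if_pos h.le, List.reverse_reverse]

theorem halfTurns_along_of_le (hP : ∀ t, P.arc t = latticePoint (X t) (Y t)) {vx vy : ℤ}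
    {K : ℕ → ℤ} {p q : ℕ} (hpq : p ≤ q) (hq : X q ≠ vx ∨ Y q ≠ vy)
    (h : ∀ t, p ≤ t → t < q → EdgeTurn X Y vx vy K t) :
    HalfTurns (P.arc p - latticePoint vx vy) (P.arc q - latticePoint vx vy)
      ((P.along p q).map fun z => z - latticePoint vx vy) (K q - K p) := by
  obtain ⟨n, rfl⟩ := Nat.exists_eq_add_of_le hpq
  have := halfTurns_range' (f := fun t => P.arc t - latticePoint vx vy) (K := K) p n
    (by rw [hP, latticePoint_sub]; exact latticePoint_ne_zero (by omega))
    (fun t h1 h2 => by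
      simp only [hP, latticePoint_sub]
      exact (h t h1 h2).halfTurn)
  rw [along, if_pos hpq, List.map_map, show p + n - p + 1 = n + 1 by omega]
  exact this

theorem halfTurns_along (hP : ∀ t, P.arc t = latticePoint (X t) (Y t)) {vx vy : ℤ}
    {K : ℕ → ℤ} {p q : ℕ} (hp : X p ≠ vx ∨ Y p ≠ vy) (hq : X q ≠ vx ∨ Y q ≠ vy)
    (h : ∀ t, min p q ≤ t → t < max p q → EdgeTurn X Y vx vy K t) :
    HalfTurns (P.arc p - latticePoint vx vy) (P.arc q - latticePoint vx vy)
      ((P.along p q).map fun z => z - latticePoint vx vy) (K q - K p) := by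
  rcases le_total p q with hpq | hpq
  · exact halfTurns_along_of_le hP hpq hq fun t h1 h2 => h t (by omega) (by omega)
  · have := (halfTurns_along_of_le hP hpq hp fun t h1 h2 => h t (by omega) (by omega)).reverse
    rwa [← List.map_reverse, along_reverse, neg_sub] at this

/-- The return path consisting of one segment. -/
theorem halfTurns_segment (hP : ∀ t, P.arc t = latticePoint (X t) (Y t)) {vx vy : ℤ} {p q : ℕ}
    {e : ℤ} (h : LatticeTurn (X p - vx) (Y p - vy) (X q - vx) (Y q - vy) e) :
    HalfTurns (P.arc p - latticePoint vx vy) (P.arc q - latticePoint vx vy)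
      ([P.arc p, P.arc q].map fun z => z - latticePoint vx vy) e := by
  have := HalfTurns.cons h.halfTurn (.single (latticePoint_ne_zero h.right_ne_zero))
  simpa [hP, latticePoint_sub] using this

theorem braidExponent_loop (hP : ∀ t, P.arc t = latticePoint (X t) (Y t)) {i j : ι} {a b : ℕ}
    {v : ℂ} {vx vy e : ℤ} {K : ℕ → ℤ} (ha : P.pos i .middle = a) (hb : P.pos j .middle = b)
    (hv : v = latticePoint vx vy) (hea : X a ≠ vx ∨ Y a ≠ vy) (heb : X b ≠ vx ∨ Y b ≠ vy)
    (h : ∀ t, min a b ≤ t → t < max a b → EdgeTurn X Y vx vy K t)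
    (hback : HalfTurns (P.arc b - latticePoint vx vy) (P.arc a - latticePoint vx vy)
      ((P.back .middle i j).map fun z => z - latticePoint vx vy) e) :
    braidExponent (fun t => (polyPath (P.loop i j) t, v)) = -(K b - K a + e) := by
  subst ha hb hv
  have := (halfTurns_along hP hea heb h).append hback
  rw [← List.map_append] at this
  exact this.braidExponent_const (.inl rfl)

theorem psi_singleton (V : Puncture) (i j : ι) :
    P.psi {V} i j = braidExponent (fun t => (polyPath (P.loop i j) t, P.puncture V)) / 2 := by
  rw [psi, Psi, Finset.sum_singleton]

theorem psi_Xm_Y (i j : ι) :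
    P.psi {.Xm, .Y} i j = (braidExponent (fun t => (polyPath (P.loop i j) t, P.puncture .Xm)) +
      braidExponent (fun t => (polyPath (P.loop i j) t, P.puncture .Y))) / 2 := by
  rw [psi, Psi, Finset.sum_pair (by decide)]

/-- Only the first point moves, so `Φ` is the turning of a closed path around the fixed position
`(vx, vy)` of the second point. -/
theorem phi_eq_of_not_between (hP : ∀ t, P.arc t = latticePoint (X t) (Y t)) {i j : ι} {s : Track}
    {a b c : ℕ} {vx vy e : ℤ} {K : ℕ → ℤ} (hs : P.place i j = s) (ha : P.pos i s = a)
    (hb : P.pos j s.opp = b) (hc : P.pos j s = c) (hvx : X b = vx) (hvy : Y b = vy)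
    (hbet : ¬((a < b ∧ b < c) ∨ (c < b ∧ b < a)))
    (hea : X a ≠ vx ∨ Y a ≠ vy) (hec : X c ≠ vx ∨ Y c ≠ vy)
    (h : ∀ t, min a c ≤ t → t < max a c → EdgeTurn X Y vx vy K t)
    (hback : HalfTurns (P.arc c - latticePoint vx vy) (P.arc a - latticePoint vx vy)
      ((P.back s i j).map fun z => z - latticePoint vx vy) e) :
    P.phi i j = -(K c - K a + e) := by
  subst hs ha hb hc hvx hvy
  have := (halfTurns_along hP hea hec h).append hback
  rw [← hP, ← List.map_append] at this
  have key : (P.pairLoop i j).map (fun p => p.1 - p.2) =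
      (P.along (P.pos i (P.place i j)) (P.pos j (P.place i j)) ++ P.back (P.place i j) i j).map
        fun z => z - P.arc (P.pos j (P.place i j).opp) := by
    simp only [pairLoop]
    rw [if_neg hbet, List.map_map]
    rfl
  rw [← key] at this
  exact this.braidExponent_polyPath (.inl rfl)

/-- Three moves contribute in turn: the second point from `b` to `c` around `a`, the first point
from `a` to `b` around `c`, and the second point back from `c` to `a` around `b`. -/
theorem phi_eq_of_between (hP : ∀ t, P.arc t = latticePoint (X t) (Y t)) {i j : ι} {s : Track}
    {a b c : ℕ} {e : ℤ} {K K' : ℕ → ℤ} (hs : P.place i j = s) (ha : P.pos i s = a)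
    (hb : P.pos j s.opp = b) (hc : P.pos j s = c)
    (hbet : (a < b ∧ b < c) ∨ (c < b ∧ b < a))
    (hab : X a ≠ X b ∨ Y a ≠ Y b) (hac : X a ≠ X c ∨ Y a ≠ Y c) (hbc : X b ≠ X c ∨ Y b ≠ Y c)
    (h : ∀ t, min b c ≤ t → t < max b c → EdgeTurn X Y (X a) (Y a) K t)
    (h' : ∀ t, min a b ≤ t → t < max a b → EdgeTurn X Y (X c) (Y c) K' t)
    (hback : HalfTurns (P.arc c - latticePoint (X b) (Y b)) (P.arc a - latticePoint (X b) (Y b))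
      ((P.back s i j).map fun z => z - latticePoint (X b) (Y b)) e) :
    P.phi i j = -((K c - K b) + (K' b - K' a) + e) := by
  subst hs ha hb hc
  -- When the second point moves, the difference is centre minus moving point. Negation preserves
  -- the number of half turns.
  have h1 := (halfTurns_along hP (by omega) (by omega) h).neg
  have h2 := halfTurns_along hP (by omega) (by omega) h'
  have h3 := hback.neg
  rw [← hP] at h1 h2 h3
  rw [neg_sub, neg_sub] at h1 h3
  have h4 := (h1.append h2).append h3
  -- The two points have exchanged places at the end, so the difference vector returns to its
  -- negative.
  refine HalfTurns.braidExponent_polyPath ?_ (.inr (neg_sub (P.arc (P.pos i (P.place i j)))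
    (P.arc (P.pos j (P.place i j).opp))).symm)
  simp only [pairLoop]
  rw [if_pos hbet]
  simpa only [List.map_append, List.map_map, Function.comp_def, neg_sub] using h4

end Picture

/-! ### The tangle -/

/-- First coordinate of the vertex `t` of `α_{2n/1}`. -/
def tangleX (n t : ℕ) : ℤ :=
  if t < 10 * n then
    match t % 10 with
    | 0 => (t / 10 : ℕ) + 2
    | 1 => 1
    | 2 => 0
    | 3 => -1
    | 4 => -((t / 10 : ℕ) + 3)
    | 5 => -((t / 10 : ℕ) + 3)
    | 6 => -1
    | 7 => 0
    | 8 => 1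
    | _ => (t / 10 : ℕ) + 3
  else n + 3 + (t - 10 * n : ℕ)

/-- Second coordinate of the vertex `t` of `α_{2n/1}`. -/
def tangleY (n t : ℕ) : ℤ :=
  if t < 10 * n then if t % 10 < 5 then -((t / 10 : ℕ) + 1) else (t / 10 : ℕ) + 1 else n

theorem tangleArc_eq (n t : ℕ) : tangleArc n t = latticePoint (tangleX n t) (tangleY n t) := by
  unfold tangleArc tangleX tangleY
  have hr : t % 10 < 10 := Nat.mod_lt _ (by norm_num)
  generalize t % 10 = r at *
  generalize t / 10 = b
  split_ifs with h
  · interval_cases r <;> apply Complex.ext <;> simp [latticePoint] <;> ring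
  · interval_cases r <;> apply Complex.ext <;> simp [latticePoint] <;> ring
  · apply Complex.ext <;> simp [latticePoint]

theorem tangle_coordinates (n b r : ℕ) (hb : b < n) (hr : r < 10) :
    tangleX n (10 * b + r) = (match (generalizing := false) r with
      | 0 => b + 2 | 1 => 1 | 2 => 0 | 3 => -1 | 4 => -(b + 3) | 5 => -(b + 3) | 6 => -1 | 7 => 0
      | 8 => 1 | _ => b + 3 : ℤ) ∧
    tangleY n (10 * b + r) = if r < 5 then -(b + 1 : ℤ) else b + 1 := by
  unfold tangleX tangleY
  rw [if_pos (by omega), if_pos (by omega), show (10 * b + r) % 10 = r by omega,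
    show (10 * b + r) / 10 = b by omega]
  exact ⟨rfl, rfl⟩

theorem tangle_coordinates_of_le {n t : ℕ} (h : 10 * n ≤ t) :
    tangleX n t = t + 3 - 9 * n ∧ tangleY n t = n := by
  unfold tangleX tangleY
  rw [if_neg (by omega), if_neg (by omega)]
  omega

/-- The edges sorted by direction (below, left, above, right, final horizontal piece), with all data
in linear form. Each later turning claim then picks one kind of `LatticeTurn` per case and is
settled by linear arithmetic. -/
theorem tangle_edge (n t : ℕ) :
    (∃ b : ℕ, b < n ∧
      ((10 * b ≤ t ∧ t ≤ 10 * b + 3 ∧ tangleX n t ≤ b + 2 ∧ tangleX n (t + 1) ≤ b + 2 ∧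
        tangleY n t = -(b + 1) ∧ tangleY n (t + 1) = -(b + 1)) ∨
      (t = 10 * b + 4 ∧ tangleX n t = -(b + 3) ∧ tangleX n (t + 1) = -(b + 3) ∧
        tangleY n t = -(b + 1) ∧ tangleY n (t + 1) = b + 1) ∨
      (10 * b + 5 ≤ t ∧ t ≤ 10 * b + 8 ∧ tangleX n t ≤ b + 3 ∧ tangleX n (t + 1) ≤ b + 3 ∧
        (t = 10 * b + 5 → tangleX n t < 0 ∧ tangleX n (t + 1) < 0) ∧
        (t = 10 * b + 8 → 0 < tangleX n t ∧ 0 < tangleX n (t + 1)) ∧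
        tangleY n t = b + 1 ∧ tangleY n (t + 1) = b + 1) ∨
      (b + 1 < n ∧ t = 10 * b + 9 ∧ tangleX n t = b + 3 ∧ tangleX n (t + 1) = b + 3 ∧
        tangleY n t = b + 1 ∧ tangleY n (t + 1) = -(b + 2)))) ∨
    (10 * n ≤ t + 1 ∧ tangleX n t ≤ t + 3 - 9 * n ∧ 0 < tangleX n t ∧
      tangleX n (t + 1) = t + 4 - 9 * n ∧ tangleY n t = n ∧ tangleY n (t + 1) = n) := by
  by_cases h : 10 * n ≤ t
  · have h1 := tangle_coordinates_of_le h
    have h2 := tangle_coordinates_of_le (n := n) (t := t + 1) (by omega)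
    right
    push_cast at h2
    omega
  obtain ⟨b, r, hr, rfl⟩ : ∃ b r, r < 10 ∧ t = 10 * b + r :=
    ⟨t / 10, t % 10, Nat.mod_lt _ (by norm_num), by omega⟩
  have hb : b < n := by omega
  have h1 := tangle_coordinates n b r hb hr
  by_cases hr9 : r = 9
  · subst hr9
    by_cases hn : b + 1 < n
    · left
      have h2 := tangle_coordinates n (b + 1) 0 hn (by norm_num)
      simp at h1 h2
      refine ⟨b, hb, .inr (.inr (.inr ?_))⟩
      rw [show 10 * b + 9 + 1 = 10 * (b + 1) by ring]
      omega
    · right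
      have h2 := tangle_coordinates_of_le (n := n) (t := 10 * b + 9 + 1) (by omega)
      simp at h1 h2
      omega
  · left
    have h2 := tangle_coordinates n b (r + 1) hb (by omega)
    refine ⟨b, hb, ?_⟩
    rw [add_assoc]
    interval_cases r <;> simp at h1 h2 hr9 ⊢ <;> omega

theorem tangle_top_coordinates {n k : ℕ} (hk : k < n) (c : Track) :
    tangleX n (10 * k + 6 + c.offset) = (c.offset : ℤ) - 1 ∧
      tangleY n (10 * k + 6 + c.offset) = k + 1 := by
  have := tangle_coordinates n k (6 + c.offset) hk (by cases c <;> decide)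
  rw [← add_assoc] at this
  cases c <;> simpa [Track.offset] using this

/-- On the spiral, the level decreases by one whenever one passes to the left or to the right of a
point near its centre. -/
theorem tangle_edgeTurn_spiral {n t : ℕ} {vx vy : ℤ} (hx : -2 ≤ vx ∧ vx ≤ 2)
    (hn : 0 ≤ vy ∧ (vy < n ∨ vy = n ∧ vx < 0))
    (h : vy ≤ (t / 10 : ℕ) ∨ vx < 0 ∧ vy = (t / 10 : ℕ) + 1 ∧ 8 ≤ t % 10) :
    EdgeTurn (tangleX n) (tangleY n) vx vy (fun t => -(min (t / 5) (2 * n - 1) : ℕ)) t := by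
  -- The quotient `t / 5` jumps exactly along the left edges `10b + 4` and the right edges `10b +
  -- 9`. The cap `2n - 1` suppresses the jump at `10n - 1`, where the arc leaves for `X⁺` instead of
  -- turning down. The hypothesis `h` says that the current turn runs outside the centre, or that it
  -- has reached the height of the centre and already lies to its right.
  simp only [EdgeTurn]
  rcases tangle_edge n t with ⟨b, hb, h1 | h1 | h1 | h1⟩ | h1
  · exact .lower (by omega) (by omega) (by omega)
  · exact .leftUp (by omega) (by omega) (by omega)
  · exact .upper (by omega) (by omega) (by omega)
  · exact .rightDown (by omega) (by omega) (by omega)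
  · exact .upper (by omega) (by omega) (by omega)

/-- This part of the arc stays to the left of `X⁺`, so its level only records whether it is above or
below the axis of the punctures. -/
theorem tangle_edgeTurn_Xp {n t : ℕ} (ht : t ≤ 10 * n + 1) :
    EdgeTurn (tangleX n) (tangleY n) (n + 6) 0 (fun t => if 0 < tangleY n t then 0 else 1) t := by
  simp only [EdgeTurn]
  rcases tangle_edge n t with ⟨b, hb, h1 | h1 | h1 | h1⟩ | h1
  · rw [if_neg (by omega), if_neg (by omega)]
    exact .lower (by omega) (by omega) (by omega)
  · rw [if_pos (by omega), if_neg (by omega)]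
    exact .leftUp (by omega) (by omega) (by omega)
  · rw [if_pos (by omega), if_pos (by omega)]
    exact .upper (by omega) (by omega) (by omega)
  · rw [if_neg (by omega), if_pos (by omega)]
    exact .leftDown (by omega) (by omega) (by omega)
  · by_cases hn : n = 0
    · subst hn
      rw [if_neg (by omega), if_neg (by omega)]
      exact .lower (by omega) (by omega) (by omega)
    · rw [if_pos (by omega), if_pos (by omega)]
      exact .upper (by omega) (by omega) (by omega)

/-- Up to the left copy of the point `top k`, the arc is below the right copy or at its height on
the left. It thus stays in the half-open lower half plane around it. -/
theorem tangle_edgeTurn_below_top {n t k : ℕ} (hk : k < n) (h : t ≤ 10 * k + 5) :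
    EdgeTurn (tangleX n) (tangleY n) 1 (k + 1) (fun _ => 0) t := by
  simp only [EdgeTurn]
  rcases tangle_edge n t with ⟨b, hb, h1 | h1 | h1 | h1⟩ | h1 <;>
    exact .lower (by omega) (by omega) (by omega)

theorem tangle_edgeTurn_below_inactive {n t : ℕ} (h : t < 10 * n) :
    EdgeTurn (tangleX n) (tangleY n) (n + 5) n (fun _ => 0) t := by
  simp only [EdgeTurn]
  rcases tangle_edge n t with ⟨b, hb, h1 | h1 | h1 | h1⟩ | h1 <;>
    exact .lower (by omega) (by omega) (by omega)

/-! ### Loops and quadratic form of the tangle -/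

section

variable {n : ℕ}

theorem tanglePicture_arc (t : ℕ) :
    (tanglePicture n).arc t = latticePoint (tangleX n t) (tangleY n t) :=
  tangleArc_eq n t

theorem halfTurns_back_top_inactive {vx vy e : ℤ} {K : ℕ → ℤ} (c : Track) (k : Fin n)
    (h0 : tangleX n (10 * n + c.offset) ≠ vx ∨ tangleY n (10 * n + c.offset) ≠ vy)
    (h : ∀ t, tangleTopPos n c ≤ t → t < 10 * n + c.offset →
      EdgeTurn (tangleX n) (tangleY n) vx vy K t)
    (h' : LatticeTurn (tangleX n (tangleTopPos n c) - vx) (tangleY n (tangleTopPos n c) - vy)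
      (tangleX n (10 * k + 6 + c.offset) - vx) (tangleY n (10 * k + 6 + c.offset) - vy) e) :
    HalfTurns ((tanglePicture n).arc (10 * n + c.offset) - latticePoint vx vy)
      ((tanglePicture n).arc (10 * k + 6 + c.offset) - latticePoint vx vy)
      (((tanglePicture n).back c (.top k) .inactive).map fun z => z - latticePoint vx vy)
      (K (tangleTopPos n c) - K (10 * n + c.offset) + e) := by
  have hle : tangleTopPos n c ≤ 10 * n + c.offset := by
    have := k.pos
    unfold tangleTopPos
    omega
  have hl := h'.left_ne_zero
  have h1 := Picture.halfTurns_along (tanglePicture_arc (n := n)) (K := K)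
    (p := 10 * n + c.offset) (q := tangleTopPos n c) h0 (by omega)
    (fun t h1 h2 => h t (by omega) (by omega))
  -- The return path lists its first vertex twice, once by itself and once as the start of the
  -- slide; the resulting constant segment makes no turn.
  have h2 := HalfTurns.cons (halfTurn_self h1.left_ne_zero) h1
  have hb : (tanglePicture n).back c (.top k) .inactive =
      ((tanglePicture n).arc (10 * n + c.offset) ::
        (tanglePicture n).along (10 * n + c.offset) (tangleTopPos n c)) ++
          [(tanglePicture n).arc (10 * k + 6 + c.offset)] := by
    rw [← Picture.along_reverse, Picture.along, if_pos hle]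
    rfl
  rw [hb, List.map_append]
  have h3 := h2.concat (e := e) (c := (tanglePicture n).arc (10 * k + 6 + c.offset) -
    latticePoint vx vy) (by simpa only [tanglePicture_arc, latticePoint_sub] using h'.halfTurn)
    (by simpa only [tanglePicture_arc, latticePoint_sub] using
      latticePoint_ne_zero h'.right_ne_zero)
  rw [zero_add] at h3
  exact h3

theorem halfTurns_back_inactive_top {vx vy e : ℤ} {K : ℕ → ℤ} (c : Track) (k : Fin n)
    (h0 : tangleX n (10 * n + c.offset) ≠ vx ∨ tangleY n (10 * n + c.offset) ≠ vy)
    (h : ∀ t, tangleTopPos n c ≤ t → t < 10 * n + c.offset →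
      EdgeTurn (tangleX n) (tangleY n) vx vy K t)
    (h' : LatticeTurn (tangleX n (10 * k + 6 + c.offset) - vx)
      (tangleY n (10 * k + 6 + c.offset) - vy)
      (tangleX n (tangleTopPos n c) - vx) (tangleY n (tangleTopPos n c) - vy) e) :
    HalfTurns ((tanglePicture n).arc (10 * k + 6 + c.offset) - latticePoint vx vy)
      ((tanglePicture n).arc (10 * n + c.offset) - latticePoint vx vy)
      (((tanglePicture n).back c .inactive (.top k)).map fun z => z - latticePoint vx vy)
      (e + (K (10 * n + c.offset) - K (tangleTopPos n c))) := by
  convert (halfTurns_back_top_inactive c k h0 h h'.symm).reverse using 1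
  · rw [← List.map_reverse]
    congr 1
    simp [tanglePicture, tangleBack, TanglePoint.isActive]
  · ring

theorem tangle_place_top_top (k l : Fin n) :
    (tanglePicture n).place (.top k) (.top l) = if k < l then .one else .two := by
  have hk := tangle_top_coordinates k.2 .middle
  have hl := tangle_top_coordinates l.2 .middle
  simp only [tanglePicture, tanglePos, tangleArc_eq, latticePoint, hk, hl, TanglePoint.isActive]
  simp

theorem tangle_inactive_coordinates (n : ℕ) (c : Track) :
    tangleX n (10 * n + c.offset) = n + 3 + c.offset ∧ tangleY n (10 * n + c.offset) = n := by
  have := tangle_coordinates_of_le (n := n) (t := 10 * n + c.offset) (by omega)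
  push_cast at this
  omega

theorem tangle_topPos_coordinates (hn : 1 ≤ n) (c : Track) :
    tangleX n (tangleTopPos n c) = (c.offset : ℤ) - 1 ∧ tangleY n (tangleTopPos n c) = n := by
  have := tangle_top_coordinates (n := n) (k := n - 1) (by omega) c
  rw [tangleTopPos]
  omega

/-- The lower point travels outwards on the left copies and stops before passing over the fixed
point on the right copy. -/
theorem tangle_phi_top_top_of_lt {k l : Fin n} (h : k < l) :
    (tanglePicture n).phi (.top k) (.top l) = 0 := by
  have hk := tangle_top_coordinates k.2 .one
  have hl := tangle_top_coordinates l.2 .one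
  have hl' := tangle_top_coordinates l.2 .two
  simp only [Track.offset, add_zero] at hk hl hl'
  have hlt : (k : ℕ) < l := h
  have key := Picture.phi_eq_of_not_between (P := tanglePicture n) (i := .top k) (j := .top l)
    (s := .one) (a := 10 * k + 6) (b := 10 * l + 6 + 2) (c := 10 * l + 6) (vx := 1) (vy := l + 1)
    (K := fun _ => 0) (e := 0) tanglePicture_arc (by rw [tangle_place_top_top, if_pos h])
    rfl rfl rfl (by omega) (by omega) (by omega) (by omega) (by omega)
    (fun t h1 h2 => tangle_edgeTurn_below_top l.2 (by omega))
    (Picture.halfTurns_segment tanglePicture_arc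
      (latticeTurn_of_lower (by omega) (by omega)))
  simpa using key

/-- The upper point spirals inwards, counterclockwise, around the fixed point on the left copy: `k -
l` full turns of two half turns each. -/
theorem tangle_phi_top_top_of_gt {k l : Fin n} (h : l < k) :
    (tanglePicture n).phi (.top k) (.top l) = -2 * (k - l) := by
  have hk := tangle_top_coordinates k.2 .two
  have hl := tangle_top_coordinates l.2 .one
  have hl' := tangle_top_coordinates l.2 .two
  simp only [Track.offset, add_zero] at hk hl hl'
  have hlt : (l : ℕ) < k := h
  have key := Picture.phi_eq_of_not_between (P := tanglePicture n) (i := .top k) (j := .top l)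
    (s := .two) (a := 10 * k + 6 + 2) (b := 10 * l + 6) (c := 10 * l + 6 + 2)
    (vx := -1) (vy := l + 1)
    (K := fun t => -(min (t / 5) (2 * n - 1) : ℕ)) (e := 0) tanglePicture_arc
    (by rw [tangle_place_top_top, if_neg h.not_gt])
    rfl rfl rfl (by omega) (by omega) (by omega) (by omega) (by omega)
    (fun t h1 h2 => tangle_edgeTurn_spiral (by omega) (by omega) (by omega))
    (Picture.halfTurns_segment tanglePicture_arc
      (latticeTurn_of_upper (by omega) (by omega)))
  rw [key]
  omega

theorem tangle_phi_top_inactive (k : Fin n) :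
    (tanglePicture n).phi (.top k) .inactive = 0 := by
  have hk := tangle_top_coordinates k.2 .one
  have hw := tangle_inactive_coordinates n .one
  have hw' := tangle_inactive_coordinates n .two
  have ht := tangle_topPos_coordinates k.pos .one
  simp only [Track.offset, add_zero] at hk hw hw' ht
  have key := Picture.phi_eq_of_not_between (P := tanglePicture n) (i := .top k) (j := .inactive)
    (s := .one) (a := 10 * k + 6) (b := 10 * n + 2) (c := 10 * n) (vx := n + 5) (vy := n)
    (K := fun _ => 0) tanglePicture_arc rfl
    rfl rfl rfl (by omega) (by omega) (by omega) (by omega) (by omega)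
    (fun t h1 h2 => tangle_edgeTurn_below_inactive (by omega))
    (halfTurns_back_top_inactive .one k (by simp only [Track.offset, add_zero]; omega)
      (fun t h1 h2 => tangle_edgeTurn_below_inactive h2)
      (latticeTurn_of_lower (by omega) (by simp only [Track.offset, add_zero]; omega)))
  simpa using key

/-- Inward travel unwinds the turns between `top k` and the outermost top point, whose index is `n -
1`. The slide back to `l_I` and the vertical segment add nothing. -/
theorem tangle_phi_inactive_top (k : Fin n) :
    (tanglePicture n).phi .inactive (.top k) = -2 * (n - 1 - k) := by
  have hk := tangle_top_coordinates k.2 .two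
  have hk' := tangle_top_coordinates k.2 .one
  have hw := tangle_inactive_coordinates n .two
  have ht := tangle_topPos_coordinates k.pos .two
  simp only [Track.offset, add_zero] at hk hk' hw ht
  have key := Picture.phi_eq_of_not_between (P := tanglePicture n) (i := .inactive) (j := .top k)
    (s := .two) (a := 10 * n + 2) (b := 10 * k + 6) (c := 10 * k + 6 + 2) (vx := -1) (vy := k + 1)
    (K := fun t => -(min (t / 5) (2 * n - 1) : ℕ)) tanglePicture_arc rfl
    rfl rfl rfl (by omega) (by omega) (by omega) (by omega) (by omega)
    (fun t h1 h2 => tangle_edgeTurn_spiral (by omega) (by omega) (by omega))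
    (halfTurns_back_inactive_top (K := fun t => -(min (t / 5) (2 * n - 1) : ℕ)) .two k
      (by simp only [Track.offset]; omega)
      (fun t h1 h2 => tangle_edgeTurn_spiral (by omega) (by omega)
        (by simp only [tangleTopPos, Track.offset] at h1; omega))
      (latticeTurn_of_upper (by simp only [Track.offset]; omega) (by omega)))
  rw [key]
  simp only [tangleTopPos, Track.offset]
  omega

theorem tanglePuncture_eq (V : Puncture) : (tanglePicture n).puncture V =
    latticePoint (match V with | .Y => -2 | .Xm => 2 | .Xp => n + 6) 0 := by
  cases V <;> apply Complex.ext <;> simp [tanglePicture, tanglePuncture, latticePoint]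

theorem tangle_psi_Xp_top_top (k l : Fin n) :
    (tanglePicture n).psi {.Xp} (.top k) (.top l) = 0 := by
  have hk := tangle_top_coordinates k.2 .middle
  have hl := tangle_top_coordinates l.2 .middle
  simp only [Track.offset] at hk hl
  rw [Picture.psi_singleton, Picture.braidExponent_loop (i := .top k) (j := .top l)
    (a := 10 * k + 6 + 1) (b := 10 * l + 6 + 1)
    (vx := n + 6) (vy := 0) (K := fun t => if 0 < tangleY n t then 0 else 1) tanglePicture_arc
    rfl rfl (tanglePuncture_eq _) (by omega) (by omega) (fun t h1 h2 => tangle_edgeTurn_Xp (by omega))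
    (Picture.halfTurns_segment tanglePicture_arc (latticeTurn_of_upper (by omega) (by omega))),
    if_pos (by omega), if_pos (by omega)]
  rfl

theorem tangle_psi_Xp_top_inactive (k : Fin n) :
    (tanglePicture n).psi {.Xp} (.top k) .inactive = 0 := by
  have hk := tangle_top_coordinates k.2 .middle
  have hl := tangle_inactive_coordinates n .middle
  have ht := tangle_topPos_coordinates k.pos .middle
  simp only [Track.offset] at hk hl
  rw [Picture.psi_singleton, Picture.braidExponent_loop (i := .top k) (j := .inactive)
    (a := 10 * k + 6 + 1) (b := 10 * n + 1)
    (vx := n + 6) (vy := 0) (K := fun t => if 0 < tangleY n t then 0 else 1) tanglePicture_arc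
    rfl rfl (tanglePuncture_eq _) (by omega) (by omega) (fun t h1 h2 => tangle_edgeTurn_Xp (by omega))
    (halfTurns_back_top_inactive (K := fun t => if 0 < tangleY n t then 0 else 1) .middle k
      (by simp only [Track.offset]; omega)
      (fun t h1 h2 => tangle_edgeTurn_Xp (by simp only [Track.offset] at h2; omega))
      (latticeTurn_of_upper (by omega) (by simp only [Track.offset]; omega)))]
  have hl' := tangle_inactive_coordinates n .middle
  rw [if_pos (by omega), if_pos (by omega), if_pos (by omega), if_pos (by omega)]
  rfl

theorem tangle_psi_Xp_inactive_top (k : Fin n) :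
    (tanglePicture n).psi {.Xp} .inactive (.top k) = 0 := by
  have hk := tangle_top_coordinates k.2 .middle
  have hl := tangle_inactive_coordinates n .middle
  have ht := tangle_topPos_coordinates k.pos .middle
  simp only [Track.offset] at hk hl
  rw [Picture.psi_singleton, Picture.braidExponent_loop (i := .inactive) (j := .top k)
    (a := 10 * n + 1) (b := 10 * k + 6 + 1)
    (vx := n + 6) (vy := 0) (K := fun t => if 0 < tangleY n t then 0 else 1) tanglePicture_arc
    rfl rfl (tanglePuncture_eq _) (by omega) (by omega) (fun t h1 h2 => tangle_edgeTurn_Xp (by omega))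
    (halfTurns_back_inactive_top (K := fun t => if 0 < tangleY n t then 0 else 1) .middle k
      (by simp only [Track.offset]; omega)
      (fun t h1 h2 => tangle_edgeTurn_Xp (by simp only [Track.offset] at h2; omega))
      (latticeTurn_of_upper (by simp only [Track.offset]; omega) (by omega)))]
  have hl' := tangle_inactive_coordinates n .middle
  rw [if_pos (by omega), if_pos (by omega), if_pos (by omega), if_pos (by omega)]
  rfl

/-- The arc encircles `X⁻` and `Y` equally often, namely `n - 1 - k` times clockwise, so both
exponents agree and the half sum equals either one. -/
theorem tangle_psi_Xm_Y_top_inactive (k : Fin n) :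
    (tanglePicture n).psi {.Xm, .Y} (.top k) .inactive = 2 * (n - 1 - k) := by
  have hk := tangle_top_coordinates k.2 .middle
  have hl := tangle_inactive_coordinates n .middle
  have ht := tangle_topPos_coordinates k.pos .middle
  simp only [Track.offset] at hk hl
  have key : ∀ (V : Puncture) (vx : ℤ), (tanglePicture n).puncture V = latticePoint vx 0 →
      -2 ≤ vx ∧ vx ≤ 2 → braidExponent (fun t =>
        (polyPath ((tanglePicture n).loop (.top k) .inactive) t, (tanglePicture n).puncture V)) =
        2 * (n - 1 - k) := fun V vx hV hx => by
    rw [Picture.braidExponent_loop (i := .top k) (j := .inactive)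
      (a := 10 * k + 6 + 1) (b := 10 * n + 1) (vx := vx) (vy := 0)
      (K := fun t => -(min (t / 5) (2 * n - 1) : ℕ)) tanglePicture_arc
      rfl rfl hV (by omega) (by omega) (fun t h1 h2 => tangle_edgeTurn_spiral hx (by omega) (by omega))
      (halfTurns_back_top_inactive (K := fun t => -(min (t / 5) (2 * n - 1) : ℕ)) .middle k
        (by simp only [Track.offset]; omega)
        (fun t h1 h2 => tangle_edgeTurn_spiral hx (by omega) (by omega))
        (latticeTurn_of_upper (by omega) (by simp only [Track.offset]; omega)))]
    simp only [tangleTopPos, Track.offset]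
    omega
  rw [Picture.psi_Xm_Y, key .Xm 2 (tanglePuncture_eq _) (by norm_num),
    key .Y (-2) (tanglePuncture_eq _) (by norm_num)]
  omega

theorem tangle_braidExponent_inactive (hn : 1 ≤ n) (V : Puncture) :
    braidExponent (fun t => (polyPath ((tanglePicture n).loop .inactive .inactive) t,
      (tanglePicture n).puncture V)) = 0 := by
  have hl := tangle_inactive_coordinates n .middle
  simp only [Track.offset] at hl
  rw [Picture.braidExponent_loop (i := .inactive) (j := .inactive)
    (a := 10 * n + 1) (b := 10 * n + 1) (vy := 0) (K := fun _ => 0) tanglePicture_arc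
    rfl rfl (tanglePuncture_eq _) (by omega) (by omega) (fun t h1 h2 => by omega)
    (Picture.halfTurns_segment tanglePicture_arc (latticeTurn_of_upper (by omega) (by omega)))]
  rfl

theorem tanglePicture_omega : (tanglePicture n).omega = .inactive :=
  rfl

theorem tangle_diagTerm_top (k : Fin n) :
    (tanglePicture n).diagTerm (.top k) = 2 * (n - 1 - k) := by
  rw [Picture.diagTerm, tanglePicture_omega, tangle_psi_Xm_Y_top_inactive,
    tangle_psi_Xp_top_inactive]
  ring

theorem tangle_diagTerm_inactive (hn : 1 ≤ n) : (tanglePicture n).diagTerm .inactive = 0 := by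
  rw [Picture.diagTerm, tanglePicture_omega, Picture.psi_Xm_Y, Picture.psi_singleton]
  simp only [tangle_braidExponent_inactive hn]
  norm_num

/-- Top twists only exchange the two left punctures, so `X⁺` stays on the right. The two hypotheses
swap roles at each twist. -/
theorem TangleState.mid_run_replicate_ne (m : ℕ) (s : TangleState) (h : s.left ≠ .Xp)
    (h' : s.mid ≠ .Xp) : (s.run (List.replicate m .T)).mid ≠ .Xp := by
  induction m generalizing s with
  | zero => exact h'
  | succ m ih => exact ih (s.twist .T) h' h

theorem TangleState.mu3_replicate (m : ℕ) (s : TangleState) (h : s.ori = .UP) :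
    s.mu3 (List.replicate m .T) = 0 := by
  induction m generalizing s with
  | zero => rfl
  | succ m ih =>
    rw [List.replicate_succ, TangleState.mu3, ih _ (by simp [TangleState.twist, h])]
    simp [TangleState.mu3Step, h]

theorem tangleDeltaZ_eq_zero (n : ℕ) : tangleDeltaZ n = 0 :=
  if_neg (TangleState.mid_run_replicate_ne _ _ (by decide) (by decide))

theorem knotMu3_eq_zero (n : ℕ) : knotMu3 n = 0 :=
  TangleState.mu3_replicate _ _ rfl

theorem tangleForm_self (i : TanglePoint n) :
    tangleForm n i i = (tanglePicture n).diagTerm i := by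
  simp [tangleForm, tangleDeltaZ_eq_zero]

theorem tangleForm_of_ne {i j : TanglePoint n} (h : i ≠ j) :
    tangleForm n i j = (tanglePicture n).diagTerm i + (tanglePicture n).offDiagTerm i j := by
  simp [tangleForm, tangleDeltaZ_eq_zero, h]

/-- The entry at `(k, l)` involves the loop from `l` to `k`. For `k < l` it runs inwards and its `-2
* (l - k)` turns the diagonal value of `k` into that of `l`; for `l < k` it contributes nothing. -/
theorem tangleForm_top_top (k l : Fin n) :
    tangleForm n (.top k) (.top l) = 2 * (n - 1 - max (k : ℤ) l) := by
  rcases lt_trichotomy k l with h | rfl | h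
  · rw [tangleForm_of_ne (by simpa using h.ne), tangle_diagTerm_top, Picture.offDiagTerm,
      tangle_phi_top_top_of_gt h, tangle_psi_Xp_top_top]
    have : (k : ℕ) < l := h
    omega
  · rw [tangleForm_self, tangle_diagTerm_top, max_self]
  · rw [tangleForm_of_ne (by simpa using h.ne'), tangle_diagTerm_top, Picture.offDiagTerm,
      tangle_phi_top_top_of_lt h, tangle_psi_Xp_top_top]
    have : (l : ℕ) < k := h
    omega

theorem tangleForm_top_inactive (k : Fin n) : tangleForm n (.top k) .inactive = 0 := by
  rw [tangleForm_of_ne (by simp), tangle_diagTerm_top, Picture.offDiagTerm,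
    tangle_phi_inactive_top, tangle_psi_Xp_inactive_top]
  ring

theorem tangleForm_inactive_top (k : Fin n) : tangleForm n .inactive (.top k) = 0 := by
  rw [tangleForm_of_ne (by simp), tangle_diagTerm_inactive k.pos, Picture.offDiagTerm,
    tangle_phi_top_inactive, tangle_psi_Xp_top_inactive]
  ring

theorem tangleForm_inactive_inactive (hn : 1 ≤ n) : tangleForm n .inactive .inactive = 0 := by
  rw [tangleForm_self, tangle_diagTerm_inactive hn]

end

/-! ### The band around the arc of the knot -/

/-- First coordinate of the vertex `t` of the strand `s`. -/
def strandX (s : ℤ) (t : ℕ) : ℤ :=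
  match t % 7 with
  | 0 => 3 * ((t / 7 : ℕ) + 1) + s
  | 1 => 3 * ((t / 7 : ℕ) + 1) + s
  | 2 => 3 * ((t / 7 : ℕ) + 1) + s
  | 3 => 3 * ((t / 7 : ℕ) + 1) + s
  | 4 => 3 * ((t / 7 : ℕ) + 1) + s
  | 5 => -(3 * ((t / 7 : ℕ) + 1) + s + 3)
  | _ => -(3 * ((t / 7 : ℕ) + 1) + s + 3)

/-- Second coordinate of the vertex `t` of the strand `s`. -/
def strandY (s : ℤ) (t : ℕ) : ℤ :=
  match t % 7 with
  | 0 => 3 * ((t / 7 : ℕ) + 1) + s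
  | 1 => 1
  | 2 => 0
  | 3 => -1
  | 4 => -(3 * ((t / 7 : ℕ) + 1) + s)
  | 5 => -(3 * ((t / 7 : ℕ) + 1) + s)
  | _ => 3 * ((t / 7 : ℕ) + 1) + s + 3

theorem bandStrand_eq (s : ℤ) (t : ℕ) :
    bandStrand s t = latticePoint (strandX s t) (strandY s t) := by
  unfold bandStrand strandX strandY
  have hr : t % 7 < 7 := Nat.mod_lt _ (by norm_num)
  generalize t % 7 = r at *
  generalize t / 7 = b
  interval_cases r <;> apply Complex.ext <;> simp [latticePoint]

theorem strand_coordinates (s : ℤ) (b r : ℕ) (hr : r < 7) :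
    strandX s (7 * b + r) =
      (if r < 5 then 3 * (b + 1) + s else -(3 * (b + 1) + s + 3)) ∧
    strandY s (7 * b + r) = (match (generalizing := false) r with
      | 0 => 3 * (b + 1) + s | 1 => 1 | 2 => 0 | 3 => -1 | 4 => -(3 * (b + 1) + s)
      | 5 => -(3 * (b + 1) + s) | _ => 3 * (b + 1) + s + 3) := by
  unfold strandX strandY
  rw [show (7 * b + r) % 7 = r by omega, show (7 * b + r) / 7 = b by omega]
  interval_cases r <;> simp

theorem strand_edge (s : ℤ) (t : ℕ) :
    ∃ b : ℕ,
      (7 * b ≤ t ∧ t ≤ 7 * b + 3 ∧ strandX s t = 3 * (b + 1) + s ∧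
        strandX s (t + 1) = 3 * (b + 1) + s ∧
        (t = 7 * b ∧ strandY s t = 3 * (b + 1) + s ∧ strandY s (t + 1) = 1 ∨
          t = 7 * b + 1 ∧ strandY s t = 1 ∧ strandY s (t + 1) = 0 ∨
          t = 7 * b + 2 ∧ strandY s t = 0 ∧ strandY s (t + 1) = -1 ∨
          t = 7 * b + 3 ∧ strandY s t = -1 ∧ strandY s (t + 1) = -(3 * (b + 1) + s))) ∨
      (t = 7 * b + 4 ∧ strandY s t = -(3 * (b + 1) + s) ∧
        strandY s (t + 1) = -(3 * (b + 1) + s)) ∨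
      (t = 7 * b + 5 ∧ strandX s t = -(3 * (b + 1) + s + 3) ∧
        strandX s (t + 1) = -(3 * (b + 1) + s + 3) ∧
        strandY s t = -(3 * (b + 1) + s) ∧ strandY s (t + 1) = 3 * (b + 1) + s + 3) ∨
      (t = 7 * b + 6 ∧ strandY s t = 3 * (b + 1) + s + 3 ∧
        strandY s (t + 1) = 3 * (b + 1) + s + 3) := by
  obtain ⟨b, r, hr, rfl⟩ : ∃ b r, r < 7 ∧ t = 7 * b + r :=
    ⟨t / 7, t % 7, Nat.mod_lt _ (by norm_num), by omega⟩
  have h1 := strand_coordinates s b r hr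
  refine ⟨b, ?_⟩
  by_cases hr6 : r = 6
  · subst hr6
    have h2 := strand_coordinates s (b + 1) 0 (by norm_num)
    simp at h1 h2
    rw [show 7 * b + 6 + 1 = 7 * (b + 1) by ring]
    omega
  · have h2 := strand_coordinates s b (r + 1) (by omega)
    rw [add_assoc]
    interval_cases r <;> simp at h1 h2 hr6 ⊢ <;> omega

/-- The level of the vertices of a strand around `(vx, vy)`, which lies to the right of the first
`c` crossings of the strand with the horizontal axis and to the left of the following ones. -/
def strandLevel (s : ℤ) (c : ℕ) (vy : ℤ) (t : ℕ) : ℤ :=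
  -- The shift `t + 1` counts the vertex `7b + 6`, already above the punctures, with the next turn.
  -- The subtraction is truncated: during the first `c` turns the centre is outside, and the level
  -- merely alternates between 0 above and 1 below. Afterwards each turn costs 2.
  -2 * ((t + 1) / 7 - c : ℕ) +
    if vy < strandY s t ∨ vy = strandY s t ∧ c ≤ t / 7 then 0 else if c ≤ t / 7 then -1 else 1

theorem strandLevel_of_upper {s vy : ℤ} {c t : ℕ}
    (h : vy < strandY s t ∨ vy = strandY s t ∧ c ≤ t / 7) :
    strandLevel s c vy t = -2 * ((t + 1) / 7 - c : ℕ) := by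
  rw [strandLevel, if_pos h, add_zero]

theorem strandLevel_of_lower_right {s vy : ℤ} {c t : ℕ} (h : strandY s t < vy) (h' : c ≤ t / 7) :
    strandLevel s c vy t = -2 * ((t + 1) / 7 - c : ℕ) - 1 := by
  rw [strandLevel, if_neg (by omega), if_pos h']
  rfl

theorem strandLevel_of_lower_left {s vy : ℤ} {c t : ℕ} (h : strandY s t ≤ vy) (h' : t / 7 < c) :
    strandLevel s c vy t = 1 := by
  rw [strandLevel, if_neg (by omega), if_neg (by omega)]
  omega

/-- The condition under which the level of a strand is `strandLevel` along the edge `t`. -/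
def StrandSide (s : ℤ) (c : ℕ) (vx vy : ℤ) (t : ℕ) : Prop :=
  -- Only the descending edges can be on the wrong side of the centre. The last alternative allows
  -- an edge on the vertical line through the centre, provided that it stays strictly above or
  -- strictly below it.
  t % 7 ≤ 3 →
    ((t / 7 : ℕ) < c ∧ 3 * ((t / 7 : ℕ) + 1) + s < vx) ∨
    (c ≤ (t / 7 : ℕ) ∧ vx < 3 * ((t / 7 : ℕ) + 1) + s) ∨
    (3 * ((t / 7 : ℕ) + 1) + s = vx ∧ (t % 7 = 0 ∧ vy = -1 ∨ t % 7 = 3 ∧ vy = 1))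

theorem strand_edgeTurn {s vx vy : ℤ} {c t : ℕ} (hs : -1 ≤ s) (hx : -3 ≤ vx)
    (hy : -1 ≤ vy ∧ vy ≤ 1) (h : StrandSide s c vx vy t) :
    EdgeTurn (strandX s) (strandY s) vx vy (strandLevel s c vy) t := by
  unfold StrandSide at h
  unfold EdgeTurn
  obtain ⟨b, h1 | h1 | h1 | h1⟩ := strand_edge s t
  · have hb : t / 7 = b := by omega
    have hb' : (t + 1) / 7 = b := by omega
    have hb'' : (t + 1 + 1) / 7 = b := by omega
    rw [hb] at h
    rcases h (by omega) with h2 | h2 | h2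
    · by_cases hu : vy < strandY s t <;> by_cases hu' : vy < strandY s (t + 1)
      · rw [strandLevel_of_upper (.inl hu), strandLevel_of_upper (.inl hu')]
        exact .upper (by omega) (by omega) (by omega)
      · rw [strandLevel_of_upper (.inl hu), strandLevel_of_lower_left (by omega) (by omega)]
        exact .leftDown (by omega) (by omega) (by omega)
      · omega
      · rw [strandLevel_of_lower_left (by omega) (by omega),
          strandLevel_of_lower_left (by omega) (by omega)]
        exact .lower (by omega) (by omega) (by omega)
    · by_cases hu : vy ≤ strandY s t <;> by_cases hu' : vy ≤ strandY s (t + 1)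
      · rw [strandLevel_of_upper (by omega), strandLevel_of_upper (by omega)]
        exact .upper (by omega) (by omega) (by omega)
      · rw [strandLevel_of_upper (t := t) (by omega),
          strandLevel_of_lower_right (by omega) (by omega)]
        exact .rightDown (by omega) (by omega) (by omega)
      · omega
      · rw [strandLevel_of_lower_right (by omega) (by omega),
          strandLevel_of_lower_right (by omega) (by omega)]
        exact .lower (by omega) (by omega) (by omega)
    · rcases h2 with ⟨h2, h3 | h3⟩
      · rw [strandLevel_of_upper (by omega), strandLevel_of_upper (by omega)]
        exact .upper (by omega) (by omega) (by omega)
      · refine .lower (by omega) (by omega) ?_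
        rcases le_or_gt c b with hc | hc
        · rw [strandLevel_of_lower_right (by omega) (by omega),
            strandLevel_of_lower_right (by omega) (by omega)]
          omega
        · rw [strandLevel_of_lower_left (by omega) (by omega),
            strandLevel_of_lower_left (by omega) (by omega)]
          omega
  · refine .lower (by omega) (by omega) ?_
    rcases le_or_gt c b with hc | hc
    · rw [strandLevel_of_lower_right (by omega) (by omega),
        strandLevel_of_lower_right (by omega) (by omega)]
      omega
    · rw [strandLevel_of_lower_left (by omega) (by omega),
        strandLevel_of_lower_left (by omega) (by omega)]
      omega
  · refine .leftUp (by omega) (by omega) ?_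
    rcases le_or_gt c b with hc | hc
    · rw [strandLevel_of_upper (by omega), strandLevel_of_lower_right (by omega) (by omega)]
      omega
    · rw [strandLevel_of_upper (by omega), strandLevel_of_lower_left (by omega) (by omega)]
      omega
  · refine .upper (by omega) (by omega) ?_
    rw [strandLevel_of_upper (by omega), strandLevel_of_upper (by omega)]
    omega

/-- First coordinate of the vertex `t` of the band. -/
def bandX (n t : ℕ) : ℤ :=
  if t ≤ 7 * n + 3 then strandX (-1) t
  else if t = 7 * n + 4 then 3 * n + 3 else strandX 1 (14 * n + 8 - t)

/-- Second coordinate of the vertex `t` of the band. -/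
def bandY (n t : ℕ) : ℤ :=
  if t ≤ 7 * n + 3 then strandY (-1) t
  else if t = 7 * n + 4 then -2 else strandY 1 (14 * n + 8 - t)

theorem bandArc_eq (n t : ℕ) : bandArc n t = latticePoint (bandX n t) (bandY n t) := by
  unfold bandArc bandX bandY
  split_ifs
  · exact_mod_cast bandStrand_eq (-1) t
  · apply Complex.ext <;> simp [latticePoint]
  · exact_mod_cast bandStrand_eq 1 _

/-- The level of the vertices of the band, where `c` and `c'` are the numbers of crossings of the
inner and the outer strand to the left of the centre. -/
def bandLevel (n c c' : ℕ) (vy : ℤ) (t : ℕ) : ℤ :=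
  if t ≤ 7 * n + 3 then strandLevel (-1) c vy t
  else if t = 7 * n + 4 then strandLevel (-1) c vy (7 * n + 3)
  -- The outer strand is traversed backwards; the constants make its level agree with that of the
  -- inner strand across the tip, where both ends are below the centre.
  else strandLevel 1 c' vy (14 * n + 8 - t) - strandLevel 1 c' vy (7 * n + 3) +
    strandLevel (-1) c vy (7 * n + 3)

theorem band_inner {n t : ℕ} (c c' : ℕ) (vy : ℤ) (h : t ≤ 7 * n + 3) :
    bandX n t = strandX (-1) t ∧ bandY n t = strandY (-1) t ∧
      bandLevel n c c' vy t = strandLevel (-1) c vy t :=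
  ⟨if_pos h, if_pos h, if_pos h⟩

theorem band_tip (n c c' : ℕ) (vy : ℤ) :
    bandX n (7 * n + 4) = 3 * n + 3 ∧ bandY n (7 * n + 4) = -2 ∧
      bandLevel n c c' vy (7 * n + 4) = strandLevel (-1) c vy (7 * n + 3) := by
  simp [bandX, bandY, bandLevel]

theorem band_outer {n t : ℕ} (c c' : ℕ) (vy : ℤ) (h : 7 * n + 5 ≤ t) :
    bandX n t = strandX 1 (14 * n + 8 - t) ∧ bandY n t = strandY 1 (14 * n + 8 - t) ∧
      bandLevel n c c' vy t = strandLevel 1 c' vy (14 * n + 8 - t) -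
        strandLevel 1 c' vy (7 * n + 3) + strandLevel (-1) c vy (7 * n + 3) := by
  unfold bandX bandY bandLevel
  rw [if_neg (by omega), if_neg (by omega), if_neg (by omega), if_neg (by omega),
    if_neg (by omega), if_neg (by omega)]
  exact ⟨rfl, rfl, rfl⟩

/-- The two edges at the tip join points of height -1, -2 and -1, so for a centre of height at least
0 they make no half turn. On the outer strand the edges of `strand_edgeTurn` are reversed. -/
theorem band_edgeTurn {n c c' t : ℕ} {vx vy : ℤ} (hx : -3 ≤ vx) (hy : -1 ≤ vy ∧ vy ≤ 1)
    (ht : t ≤ 14 * n + 7) (h : t ≤ 7 * n + 2 → StrandSide (-1) c vx vy t)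
    (htip : 7 * n + 3 ≤ t → t ≤ 7 * n + 4 → 0 ≤ vy)
    (h' : 7 * n + 5 ≤ t → StrandSide 1 c' vx vy (14 * n + 7 - t)) :
    EdgeTurn (bandX n) (bandY n) vx vy (bandLevel n c c' vy) t := by
  unfold EdgeTurn
  rcases le_or_gt t (7 * n + 2) with h1 | h1
  · obtain ⟨e1, e2, e3⟩ := band_inner (n := n) (t := t) c c' vy (by omega)
    obtain ⟨e4, e5, e6⟩ := band_inner (n := n) (t := t + 1) c c' vy (by omega)
    rw [e1, e2, e3, e4, e5, e6]
    exact strand_edgeTurn (by norm_num) hx hy (h h1)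
  rcases le_or_gt (7 * n + 5) t with h2 | h2
  · obtain ⟨e1, e2, e3⟩ := band_outer (n := n) (t := t) c c' vy (by omega)
    obtain ⟨e4, e5, e6⟩ := band_outer (n := n) (t := t + 1) c c' vy (by omega)
    rw [e1, e2, e3, e4, e5, e6]
    have := LatticeTurn.symm (strand_edgeTurn (by norm_num) hx hy (h' h2))
    rw [show 14 * n + 7 - t + 1 = 14 * n + 8 - t by omega,
      show 14 * n + 7 - t = 14 * n + 8 - (t + 1) by omega] at this
    convert this using 1
    ring
  · have hv := htip (by omega) (by omega)
    have y1 : strandY (-1) (7 * n + 3) = -1 := (strand_coordinates (-1) n 3 (by norm_num)).2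
    have y2 : strandY 1 (7 * n + 3) = -1 := (strand_coordinates 1 n 3 (by norm_num)).2
    obtain ⟨-, e2, e3⟩ := band_tip n c c' vy
    rcases (by omega : t = 7 * n + 3 ∨ t = 7 * n + 4) with rfl | rfl
    · obtain ⟨-, e5, e6⟩ := band_inner (n := n) (t := 7 * n + 3) c c' vy (by omega)
      rw [show 7 * n + 3 + 1 = 7 * n + 4 from rfl]
      exact .lower (by omega) (by omega) (by omega)
    · obtain ⟨-, e5, e6⟩ := band_outer (n := n) (t := 7 * n + 4 + 1) c c' vy (by omega)
      rw [show 14 * n + 8 - (7 * n + 4 + 1) = 7 * n + 3 by omega] at e5 e6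
      exact .lower (by omega) (by omega) (by omega)

theorem strand_crossing (s : ℤ) (k : ℕ) {r : ℕ} (hr : 1 ≤ r ∧ r ≤ 3) :
    strandX s (7 * k + r) = 3 * (k + 1) + s ∧ strandY s (7 * k + r) = 2 - r := by
  have := strand_coordinates s k r (by omega)
  obtain ⟨h1, h2⟩ := hr
  interval_cases r <;> simpa using this

/-- The level of a strand in the point of height `y` near its crossing `k` with the horizontal
axis. -/
def crossingLevel (c k : ℕ) (vy y : ℤ) : ℤ :=
  -2 * (k - c : ℕ) + if vy < y ∨ vy = y ∧ c ≤ k then 0 else if c ≤ k then -1 else 1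

theorem strandLevel_crossing (s : ℤ) (c k : ℕ) (vy : ℤ) {r : ℕ} (hr : 1 ≤ r ∧ r ≤ 3) :
    strandLevel s c vy (7 * k + r) = crossingLevel c k vy (2 - r) := by
  rw [strandLevel, crossingLevel, (strand_crossing s k hr).2,
    show (7 * k + r + 1) / 7 = k by omega, show (7 * k + r) / 7 = k by omega]

theorem band_inner_crossing {n k r : ℕ} (h : k ≤ n) (hr : 1 ≤ r ∧ r ≤ 3) :
    bandX n (7 * k + r) = 3 * k + 2 ∧ bandY n (7 * k + r) = 2 - r ∧
      ∀ (c c' : ℕ) (vy : ℤ), bandLevel n c c' vy (7 * k + r) = crossingLevel c k vy (2 - r) := by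
  have hi := fun c c' vy => band_inner (n := n) (t := 7 * k + r) c c' vy (by omega)
  obtain ⟨h4, h5⟩ := strand_crossing (-1) k hr
  refine ⟨?_, ?_, fun c c' vy => ?_⟩
  · rw [(hi 0 0 0).1, h4]; ring
  · rw [(hi 0 0 0).2.1, h5]
  · rw [(hi c c' vy).2.2, strandLevel_crossing _ _ _ _ hr]

theorem band_outer_crossing {n k r : ℕ} (h : k < n) (hr : 1 ≤ r ∧ r ≤ 3) :
    bandX n (14 * n + 8 - (7 * k + r)) = 3 * k + 4 ∧
      bandY n (14 * n + 8 - (7 * k + r)) = 2 - r ∧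
      ∀ (c c' : ℕ) (vy : ℤ), bandLevel n c c' vy (14 * n + 8 - (7 * k + r)) =
        crossingLevel c' k vy (2 - r) - crossingLevel c' n vy (-1) + crossingLevel c n vy (-1) := by
  have hi := fun c c' vy => band_outer (n := n) (t := 14 * n + 8 - (7 * k + r)) c c' vy (by omega)
  rw [show 14 * n + 8 - (14 * n + 8 - (7 * k + r)) = 7 * k + r by omega] at hi
  obtain ⟨h4, h5⟩ := strand_crossing 1 k hr
  refine ⟨?_, ?_, fun c c' vy => ?_⟩
  · rw [(hi 0 0 0).1, h4]; ring
  · rw [(hi 0 0 0).2.1, h5]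
  · rw [(hi c c' vy).2.2, strandLevel_crossing _ _ _ _ hr,
      strandLevel_crossing _ _ _ _ (by norm_num : 1 ≤ 3 ∧ 3 ≤ 3),
      strandLevel_crossing _ _ _ _ (by norm_num : 1 ≤ 3 ∧ 3 ≤ 3)]
    rfl

/-! ### The quadratic form of the knot -/

section

variable {n : ℕ}

theorem knotPicture_arc (t : ℕ) :
    (knotPicture n).arc t = latticePoint (bandX n t) (bandY n t) :=
  bandArc_eq n t

/-- `i` lies on the inner strand (or is the last point), at the crossing `k`. -/
structure KnotPoint.IsInner (i : KnotPoint n) (k : ℕ) : Prop where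
  le : k ≤ n
  pos_one : (knotPicture n).pos i .one = 7 * k + 1
  pos_middle : (knotPicture n).pos i .middle = 7 * k + 2
  pos_two : (knotPicture n).pos i .two = 7 * k + 3

/-- `i` lies on the outer strand, at the crossing `k`. -/
structure KnotPoint.IsOuter (i : KnotPoint n) (k : ℕ) : Prop where
  lt : k < n
  pos_one : (knotPicture n).pos i .one = 14 * n + 8 - (7 * k + 1)
  pos_middle : (knotPicture n).pos i .middle = 14 * n + 8 - (7 * k + 2)
  pos_two : (knotPicture n).pos i .two = 14 * n + 8 - (7 * k + 3)

theorem KnotPoint.isInner_inner (k : Fin n) : (KnotPoint.inner k).IsInner k :=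
  ⟨k.2.le, rfl, rfl, rfl⟩

theorem KnotPoint.isInner_last : (KnotPoint.last : KnotPoint n).IsInner n :=
  ⟨le_rfl, rfl, rfl, rfl⟩

theorem KnotPoint.isOuter_outer (k : Fin n) : (KnotPoint.outer k).IsOuter k :=
  ⟨k.2, rfl, rfl, rfl⟩

theorem knot_place_of_lt {i j : KnotPoint n} {a b : ℕ} (hi : (knotPicture n).pos i .middle = a)
    (hj : (knotPicture n).pos j .middle = b) (h : bandX n a < bandX n b) :
    (knotPicture n).place i j = .one := by
  subst hi hj
  refine if_pos ?_
  rw [bandArc_eq, bandArc_eq]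
  exact Int.cast_lt.2 h

theorem knot_place_of_gt {i j : KnotPoint n} {a b : ℕ} (hi : (knotPicture n).pos i .middle = a)
    (hj : (knotPicture n).pos j .middle = b) (h : bandX n b < bandX n a) :
    (knotPicture n).place i j = .two := by
  subst hi hj
  refine if_neg ?_
  rw [bandArc_eq, bandArc_eq]
  exact not_lt.2 (Int.cast_le.2 h.le)

theorem knot_halfTurns_back {i j : KnotPoint n} {o : Track} {a b : ℕ} {vx vy e : ℤ}
    (ha : (knotPicture n).pos i o = a) (hb : (knotPicture n).pos j o = b)
    (h : LatticeTurn (bandX n b - vx) (bandY n b - vy) (bandX n a - vx) (bandY n a - vy) e) :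
    HalfTurns ((knotPicture n).arc b - latticePoint vx vy)
      ((knotPicture n).arc a - latticePoint vx vy)
      (((knotPicture n).back o i j).map fun z => z - latticePoint vx vy) e := by
  subst ha hb
  exact Picture.halfTurns_segment knotPicture_arc h

/-- The points on the inner strand at the crossing `k`. -/
theorem band_inner_points {k : ℕ} (h : k ≤ n) :
    (bandX n (7 * k + 1) = 3 * k + 2 ∧ bandY n (7 * k + 1) = 1) ∧
    (bandX n (7 * k + 2) = 3 * k + 2 ∧ bandY n (7 * k + 2) = 0) ∧
    (bandX n (7 * k + 3) = 3 * k + 2 ∧ bandY n (7 * k + 3) = -1) := by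
  have h1 := band_inner_crossing (r := 1) h (by norm_num)
  have h2 := band_inner_crossing (r := 2) h (by norm_num)
  have h3 := band_inner_crossing (r := 3) h (by norm_num)
  exact ⟨⟨h1.1, h1.2.1⟩, ⟨h2.1, h2.2.1⟩, ⟨h3.1, h3.2.1⟩⟩

/-- The points on the outer strand at the crossing `k`. -/
theorem band_outer_points {k : ℕ} (h : k < n) :
    (bandX n (14 * n + 8 - (7 * k + 1)) = 3 * k + 4 ∧ bandY n (14 * n + 8 - (7 * k + 1)) = 1) ∧
    (bandX n (14 * n + 8 - (7 * k + 2)) = 3 * k + 4 ∧ bandY n (14 * n + 8 - (7 * k + 2)) = 0) ∧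
    (bandX n (14 * n + 8 - (7 * k + 3)) = 3 * k + 4 ∧ bandY n (14 * n + 8 - (7 * k + 3)) = -1) := by
  have h1 := band_outer_crossing (r := 1) h (by norm_num)
  have h2 := band_outer_crossing (r := 2) h (by norm_num)
  have h3 := band_outer_crossing (r := 3) h (by norm_num)
  exact ⟨⟨h1.1, h1.2.1⟩, ⟨h2.1, h2.2.1⟩, ⟨h3.1, h3.2.1⟩⟩

theorem knot_phi_inner_inner_of_lt {i j : KnotPoint n} {k l : ℕ} (hi : i.IsInner k)
    (hj : j.IsInner l) (h : k < l) : (knotPicture n).phi i j = 0 := by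
  have hk := band_inner_points hi.le
  have hl := band_inner_points hj.le
  have hln := hj.le
  rw [Picture.phi_eq_of_not_between (e := 0) (K := bandLevel n l l (-1))
    (vx := 3 * l + 2) (vy := -1) knotPicture_arc
    (knot_place_of_lt hi.pos_middle hj.pos_middle (by omega)) hi.pos_one hj.pos_two hj.pos_one
    (by omega) (by omega) (by omega) (by omega) (by omega)
    (fun t h1 h2 => band_edgeTurn (by omega) (by omega) (by omega)
      (by unfold StrandSide; omega) (by omega) (by omega))
    (knot_halfTurns_back hi.pos_one hj.pos_one (latticeTurn_of_upper (by omega) (by omega))),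
    (band_inner_crossing hj.le (by norm_num)).2.2, (band_inner_crossing hi.le (by norm_num)).2.2]
  norm_num [crossingLevel]
  omega

/-- As in the tangle: inward travel along the strand makes `k - l` counterclockwise turns around the
fixed point. -/
theorem knot_phi_inner_inner_of_gt {i j : KnotPoint n} {k l : ℕ} (hi : i.IsInner k)
    (hj : j.IsInner l) (h : l < k) : (knotPicture n).phi i j = -2 * (k - l) := by
  have hk := band_inner_points hi.le
  have hl := band_inner_points hj.le
  have hkn := hi.le
  have hln := hj.le
  rw [Picture.phi_eq_of_not_between (e := 0) (K := bandLevel n (l) (l) (1))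
    (vx := 3 * l + 2) (vy := 1) knotPicture_arc
    (knot_place_of_gt hi.pos_middle hj.pos_middle (by omega)) hi.pos_two hj.pos_one hj.pos_two
    (by omega) (by omega) (by omega) (by omega) (by omega)
    (fun t h1 h2 => band_edgeTurn (by omega) (by omega) (by omega)
      (by unfold StrandSide; omega) (by omega) (by unfold StrandSide; omega))
    (knot_halfTurns_back hi.pos_two hj.pos_two (latticeTurn_of_lower (by omega) (by omega))),
    (band_inner_crossing hj.le (by norm_num)).2.2, (band_inner_crossing hi.le (by norm_num)).2.2]
  norm_num [crossingLevel]
  split_ifs <;> omega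

theorem knot_phi_outer_outer_of_lt {i j : KnotPoint n} {k l : ℕ} (hi : i.IsOuter k)
    (hj : j.IsOuter l) (h : k < l) : (knotPicture n).phi i j = 0 := by
  have hk := band_outer_points hi.lt
  have hl := band_outer_points hj.lt
  have hkn := hi.lt
  have hln := hj.lt
  -- The path stays on the outer strand, where the inner count only adds a constant to the level;
  -- its value is immaterial.
  rw [Picture.phi_eq_of_not_between (e := 0) (K := bandLevel n (l) (l) (-1))
    (vx := 3 * l + 4) (vy := -1) knotPicture_arc
    (knot_place_of_lt hi.pos_middle hj.pos_middle (by omega)) hi.pos_one hj.pos_two hj.pos_one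
    (by omega) (by omega) (by omega) (by omega) (by omega)
    (fun t h1 h2 => band_edgeTurn (by omega) (by omega) (by omega)
      (by unfold StrandSide; omega) (by omega) (by unfold StrandSide; omega))
    (knot_halfTurns_back hi.pos_one hj.pos_one (latticeTurn_of_upper (by omega) (by omega))),
    (band_outer_crossing hj.lt (by norm_num)).2.2, (band_outer_crossing hi.lt (by norm_num)).2.2]
  norm_num [crossingLevel]
  omega

theorem knot_phi_outer_outer_of_gt {i j : KnotPoint n} {k l : ℕ} (hi : i.IsOuter k)
    (hj : j.IsOuter l) (h : l < k) : (knotPicture n).phi i j = -2 * (k - l) := by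
  have hk := band_outer_points hi.lt
  have hl := band_outer_points hj.lt
  have hkn := hi.lt
  have hln := hj.lt
  rw [Picture.phi_eq_of_not_between (e := 0) (K := bandLevel n (l) (l) (1))
    (vx := 3 * l + 4) (vy := 1) knotPicture_arc
    (knot_place_of_gt hi.pos_middle hj.pos_middle (by omega)) hi.pos_two hj.pos_one hj.pos_two
    (by omega) (by omega) (by omega) (by omega) (by omega)
    (fun t h1 h2 => band_edgeTurn (by omega) (by omega) (by omega)
      (by unfold StrandSide; omega) (by omega) (by unfold StrandSide; omega))
    (knot_halfTurns_back hi.pos_two hj.pos_two (latticeTurn_of_lower (by omega) (by omega))),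
    (band_outer_crossing hj.lt (by norm_num)).2.2, (band_outer_crossing hi.lt (by norm_num)).2.2]
  norm_num [crossingLevel]
  split_ifs <;> omega

/-- The path runs outwards on the outer strand, around the tip and inwards on the inner strand to
crossing `l`. The turns beyond crossing `k` cancel, leaving `k - l` counterclockwise turns. -/
theorem knot_phi_outer_inner_of_ge {i j : KnotPoint n} {k l : ℕ} (hi : i.IsOuter k)
    (hj : j.IsInner l) (h : l ≤ k) : (knotPicture n).phi i j = -2 * (k - l) := by
  have hk := band_outer_points hi.lt
  have hl := band_inner_points hj.le
  have hkn := hi.lt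
  have hln := hj.le
  rw [Picture.phi_eq_of_not_between (e := 0) (K := bandLevel n (l) (l) (1))
    (vx := 3 * l + 2) (vy := 1) knotPicture_arc
    (knot_place_of_gt hi.pos_middle hj.pos_middle (by omega)) hi.pos_two hj.pos_one hj.pos_two
    (by omega) (by omega) (by omega) (by omega) (by omega)
    (fun t h1 h2 => band_edgeTurn (by omega) (by omega) (by omega)
      (by unfold StrandSide; omega) (by omega) (by unfold StrandSide; omega))
    (knot_halfTurns_back hi.pos_two hj.pos_two (latticeTurn_of_lower (by omega) (by omega))),
    (band_inner_crossing hj.le (by norm_num)).2.2, (band_outer_crossing hi.lt (by norm_num)).2.2]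
  norm_num [crossingLevel]
  split_ifs
  omega

theorem knot_phi_inner_outer_of_gt {i j : KnotPoint n} {k l : ℕ} (hi : i.IsInner k)
    (hj : j.IsOuter l) (h : l < k) : (knotPicture n).phi i j = -2 * (k - l) := by
  have hk := band_inner_points hi.le
  have hl := band_outer_points hj.lt
  have hkn := hi.le
  have hln := hj.lt
  -- Left of the centre `x = 3l + 4` lie the inner crossings `3m + 2` with `m ≤ l`, but the outer
  -- crossings `3m + 4` only with `m < l`.
  rw [Picture.phi_eq_of_not_between (e := 0) (K := bandLevel n (l + 1) (l) (1))
    (vx := 3 * l + 4) (vy := 1) knotPicture_arc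
    (knot_place_of_gt hi.pos_middle hj.pos_middle (by omega)) hi.pos_two hj.pos_one hj.pos_two
    (by omega) (by omega) (by omega) (by omega) (by omega)
    (fun t h1 h2 => band_edgeTurn (by omega) (by omega) (by omega)
      (by unfold StrandSide; omega) (by omega) (by unfold StrandSide; omega))
    (knot_halfTurns_back hi.pos_two hj.pos_two (latticeTurn_of_lower (by omega) (by omega))),
    (band_outer_crossing hj.lt (by norm_num)).2.2, (band_inner_crossing hi.le (by norm_num)).2.2]
  norm_num [crossingLevel]
  split_ifs <;> omega

/-- The target on the lower copy is met first, so the points exchange places. The step of the second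
point up to the top copy, to the right of the first point, is one counterclockwise half turn; the
other two moves contribute zero in total. -/
theorem knot_phi_inner_outer_of_le {i j : KnotPoint n} {k l : ℕ} (hi : i.IsInner k)
    (hj : j.IsOuter l) (h : k ≤ l) : (knotPicture n).phi i j = -1 := by
  obtain ⟨ha, -⟩ := band_inner_points hi.le
  have hk := band_inner_points hi.le
  obtain ⟨hc, -⟩ := band_outer_points hj.lt
  have hl := band_outer_points hj.lt
  have hkn := hi.le
  have hln := hj.lt
  rw [Picture.phi_eq_of_between (e := 0) (K := bandLevel n 0 0 1) (K' := bandLevel n (l + 1) l 1)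
    knotPicture_arc
    (knot_place_of_lt hi.pos_middle hj.pos_middle (by omega)) hi.pos_one hj.pos_two hj.pos_one
    (by omega) (by omega) (by omega) (by omega)
    (fun t h1 h2 => by
      rw [ha.1, ha.2]
      exact band_edgeTurn (by omega) (by omega) (by omega)
        (by unfold StrandSide; omega) (by omega) (by unfold StrandSide; omega))
    (fun t h1 h2 => by
      rw [hc.1, hc.2]
      exact band_edgeTurn (by omega) (by omega) (by omega)
        (by unfold StrandSide; omega) (by omega) (by unfold StrandSide; omega))
    (knot_halfTurns_back hi.pos_one hj.pos_one (latticeTurn_of_upper (by omega) (by omega))),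
    (band_outer_crossing hj.lt (by norm_num)).2.2, (band_outer_crossing hj.lt (by norm_num)).2.2,
    (band_outer_crossing hj.lt (by norm_num)).2.2, (band_inner_crossing hi.le (by norm_num)).2.2]
  norm_num [crossingLevel]
  split_ifs <;> omega

/-- Again the points exchange places. The step up gives one counterclockwise half turn, and the
passage of the first point around the target gives two clockwise ones. The net value 1 is the source
of `L` and `U`. -/
theorem knot_phi_outer_inner_of_lt {i j : KnotPoint n} {k l : ℕ} (hi : i.IsOuter k)
    (hj : j.IsInner l) (h : k < l) : (knotPicture n).phi i j = 1 := by
  obtain ⟨ha, -⟩ := band_outer_points hi.lt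
  have hk := band_outer_points hi.lt
  obtain ⟨hc, -⟩ := band_inner_points hj.le
  have hl := band_inner_points hj.le
  have hkn := hi.lt
  have hln := hj.le
  rw [Picture.phi_eq_of_between (e := 0) (K := bandLevel n 0 0 1) (K' := bandLevel n (l) l 1)
    knotPicture_arc
    (knot_place_of_lt hi.pos_middle hj.pos_middle (by omega)) hi.pos_one hj.pos_two hj.pos_one
    (by omega) (by omega) (by omega) (by omega)
    (fun t h1 h2 => by
      rw [ha.1, ha.2]
      exact band_edgeTurn (by omega) (by omega) (by omega)
        (by unfold StrandSide; omega) (by omega) (by unfold StrandSide; omega))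
    (fun t h1 h2 => by
      rw [hc.1, hc.2]
      exact band_edgeTurn (by omega) (by omega) (by omega)
        (by unfold StrandSide; omega) (by omega) (by unfold StrandSide; omega))
    (knot_halfTurns_back hi.pos_one hj.pos_one (latticeTurn_of_upper (by omega) (by omega))),
    (band_inner_crossing hj.le (by norm_num)).2.2, (band_inner_crossing hj.le (by norm_num)).2.2,
    (band_inner_crossing hj.le (by norm_num)).2.2, (band_outer_crossing hi.lt (by norm_num)).2.2]
  norm_num [crossingLevel]
  split_ifs <;> omega

/-! ### Windings around the punctures and entries of the knot form -/

theorem knotPuncture_eq (V : Puncture) : (knotPicture n).puncture V =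
    latticePoint (match V with | .Xm => -3 | .Y => 0 | .Xp => 3 * n + 3) 0 := by
  cases V <;> apply Complex.ext <;> simp [knotPicture, knotPuncture, latticePoint]

/-- All inner crossings `0, …, n` lie to the left of `X⁺`, but only the outer crossings `0, …, n -
1` do; the end of the outer strand passes on its right. This explains the counts `n + 1` and `n`. -/
theorem knot_edgeTurn_Xp (t : ℕ) (ht : t ≤ 14 * n + 7) :
    EdgeTurn (bandX n) (bandY n) (3 * n + 3) 0 (bandLevel n (n + 1) n 0) t :=
  band_edgeTurn (by omega) (by omega) ht (by unfold StrandSide; omega) (by omega)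
    (by unfold StrandSide; omega)

theorem knot_edgeTurn_Xm_Y {vx : ℤ} (hx : -3 ≤ vx ∧ vx ≤ 0) (t : ℕ) (ht : t ≤ 14 * n + 7) :
    EdgeTurn (bandX n) (bandY n) vx 0 (bandLevel n 0 0 0) t :=
  band_edgeTurn (by omega) (by omega) ht (by unfold StrandSide; omega) (by omega)
    (by unfold StrandSide; omega)

theorem knot_psi_Xp_inner_inner {i j : KnotPoint n} {k l : ℕ} (hi : i.IsInner k)
    (hj : j.IsInner l) : (knotPicture n).psi {.Xp} i j = 0 := by
  have hk := band_inner_points hi.le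
  have hl := band_inner_points hj.le
  have hkn := hi.le
  have hln := hj.le
  rw [Picture.psi_singleton, Picture.braidExponent_loop (e := 0) (vx := 3 * n + 3) (vy := 0)
    (K := bandLevel n (n + 1) n 0) knotPicture_arc hi.pos_middle hj.pos_middle
    (knotPuncture_eq _) (by omega) (by omega) (fun t h1 h2 => knot_edgeTurn_Xp t (by omega))
    (knot_halfTurns_back hi.pos_middle hj.pos_middle
      (latticeTurn_of_lower (by omega) (by omega))),
    (band_inner_crossing hj.le (by norm_num)).2.2, (band_inner_crossing hi.le (by norm_num)).2.2]
  norm_num [crossingLevel]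
  split_ifs <;> omega

/-- Passing from the inner to the outer strand means going once around the tip, down on the left of
`X⁺` and up on its right: one counterclockwise turn. The remaining windings cancel. -/
theorem knot_psi_Xp_inner_outer {i j : KnotPoint n} {k l : ℕ} (hi : i.IsInner k)
    (hj : j.IsOuter l) : (knotPicture n).psi {.Xp} i j = -1 := by
  have hk := band_inner_points hi.le
  have hl := band_outer_points hj.lt
  have hkn := hi.le
  have hln := hj.lt
  rw [Picture.psi_singleton, Picture.braidExponent_loop (e := 0) (vx := 3 * n + 3) (vy := 0)
    (K := bandLevel n (n + 1) n 0) knotPicture_arc hi.pos_middle hj.pos_middle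
    (knotPuncture_eq _) (by omega) (by omega) (fun t h1 h2 => knot_edgeTurn_Xp t (by omega))
    (knot_halfTurns_back hi.pos_middle hj.pos_middle
      (latticeTurn_of_lower (by omega) (by omega))),
    (band_outer_crossing hj.lt (by norm_num)).2.2, (band_inner_crossing hi.le (by norm_num)).2.2]
  norm_num [crossingLevel]
  split_ifs <;> omega

theorem knot_psi_Xp_outer_inner {i j : KnotPoint n} {k l : ℕ} (hi : i.IsOuter k)
    (hj : j.IsInner l) : (knotPicture n).psi {.Xp} i j = 1 := by
  have hk := band_outer_points hi.lt
  have hl := band_inner_points hj.le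
  have hkn := hi.lt
  have hln := hj.le
  rw [Picture.psi_singleton, Picture.braidExponent_loop (e := 0) (vx := 3 * n + 3) (vy := 0)
    (K := bandLevel n (n + 1) n 0) knotPicture_arc hi.pos_middle hj.pos_middle
    (knotPuncture_eq _) (by omega) (by omega) (fun t h1 h2 => knot_edgeTurn_Xp t (by omega))
    (knot_halfTurns_back hi.pos_middle hj.pos_middle
      (latticeTurn_of_lower (by omega) (by omega))),
    (band_inner_crossing hj.le (by norm_num)).2.2, (band_outer_crossing hi.lt (by norm_num)).2.2]
  norm_num [crossingLevel]
  split_ifs <;> omega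

theorem knot_psi_Xp_outer_outer {i j : KnotPoint n} {k l : ℕ} (hi : i.IsOuter k)
    (hj : j.IsOuter l) : (knotPicture n).psi {.Xp} i j = 0 := by
  have hk := band_outer_points hi.lt
  have hl := band_outer_points hj.lt
  have hkn := hi.lt
  have hln := hj.lt
  rw [Picture.psi_singleton, Picture.braidExponent_loop (e := 0) (vx := 3 * n + 3) (vy := 0)
    (K := bandLevel n (n + 1) n 0) knotPicture_arc hi.pos_middle hj.pos_middle
    (knotPuncture_eq _) (by omega) (by omega) (fun t h1 h2 => knot_edgeTurn_Xp t (by omega))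
    (knot_halfTurns_back hi.pos_middle hj.pos_middle
      (latticeTurn_of_lower (by omega) (by omega))),
    (band_outer_crossing hj.lt (by norm_num)).2.2, (band_outer_crossing hi.lt (by norm_num)).2.2]
  norm_num [crossingLevel]
  split_ifs <;> omega

theorem knot_psi_Xm_Y_inner_last {i : KnotPoint n} {k : ℕ} (hi : i.IsInner k) :
    (knotPicture n).psi {.Xm, .Y} i .last = 2 * (n - k) := by
  have hj := KnotPoint.isInner_last (n := n)
  have hk := band_inner_points hi.le
  have hl := band_inner_points hj.le
  have hkn := hi.le
  have key : ∀ (V : Puncture) (vx : ℤ), (knotPicture n).puncture V = latticePoint vx 0 →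
      -3 ≤ vx ∧ vx ≤ 0 → braidExponent (fun t =>
        (polyPath ((knotPicture n).loop i .last) t, (knotPicture n).puncture V)) =
        2 * (n - k) := fun V vx hV hx => by
    rw [Picture.braidExponent_loop (e := 0) (K := bandLevel n 0 0 0) knotPicture_arc
      hi.pos_middle hj.pos_middle hV (by omega) (by omega)
      (fun t h1 h2 => knot_edgeTurn_Xm_Y hx t (by omega))
      (knot_halfTurns_back hi.pos_middle hj.pos_middle
        (latticeTurn_of_upper (by omega) (by omega))),
      (band_inner_crossing hj.le (by norm_num)).2.2, (band_inner_crossing hi.le (by norm_num)).2.2]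
    norm_num [crossingLevel]
    omega
  rw [Picture.psi_Xm_Y, key .Xm (-3) (knotPuncture_eq _) (by norm_num),
    key .Y 0 (knotPuncture_eq _) (by norm_num)]
  omega

theorem knot_psi_Xm_Y_outer_last {i : KnotPoint n} {k : ℕ} (hi : i.IsOuter k) :
    (knotPicture n).psi {.Xm, .Y} i .last = 2 * (n - k) := by
  have hj := KnotPoint.isInner_last (n := n)
  have hk := band_outer_points hi.lt
  have hl := band_inner_points hj.le
  have hkn := hi.lt
  have key : ∀ (V : Puncture) (vx : ℤ), (knotPicture n).puncture V = latticePoint vx 0 →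
      -3 ≤ vx ∧ vx ≤ 0 → braidExponent (fun t =>
        (polyPath ((knotPicture n).loop i .last) t, (knotPicture n).puncture V)) =
        2 * (n - k) := fun V vx hV hx => by
    rw [Picture.braidExponent_loop (e := 0) (K := bandLevel n 0 0 0) knotPicture_arc
      hi.pos_middle hj.pos_middle hV (by omega) (by omega)
      (fun t h1 h2 => knot_edgeTurn_Xm_Y hx t (by omega))
      (knot_halfTurns_back hi.pos_middle hj.pos_middle
        (latticeTurn_of_upper (by omega) (by omega))),
      (band_inner_crossing hj.le (by norm_num)).2.2, (band_outer_crossing hi.lt (by norm_num)).2.2]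
    norm_num [crossingLevel]
    omega
  rw [Picture.psi_Xm_Y, key .Xm (-3) (knotPuncture_eq _) (by norm_num),
    key .Y 0 (knotPuncture_eq _) (by norm_num)]
  omega

theorem knotPicture_omega : (knotPicture n).omega = .last :=
  rfl

theorem knot_diagTerm_inner {i : KnotPoint n} {k : ℕ} (hi : i.IsInner k) :
    (knotPicture n).diagTerm i = 2 * (n - k) := by
  rw [Picture.diagTerm, knotPicture_omega, knot_psi_Xm_Y_inner_last hi,
    knot_psi_Xp_inner_inner hi KnotPoint.isInner_last]
  ring

theorem knot_diagTerm_outer {i : KnotPoint n} {k : ℕ} (hi : i.IsOuter k) :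
    (knotPicture n).diagTerm i = 2 * (n - k) - 3 := by
  rw [Picture.diagTerm, knotPicture_omega, knot_psi_Xm_Y_outer_last hi,
    knot_psi_Xp_outer_inner hi KnotPoint.isInner_last]
  ring

theorem knotForm_self (i : KnotPoint n) : knotForm n i i = (knotPicture n).diagTerm i := by
  simp [knotForm, knotMu3_eq_zero]

theorem knotForm_of_ne {i j : KnotPoint n} (h : i ≠ j) :
    knotForm n i j = (knotPicture n).diagTerm i + (knotPicture n).offDiagTerm i j := by
  simp [knotForm, knotMu3_eq_zero, h]

/-- Stated through `IsInner` so that it covers the last point, as crossing `n`, together with the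
inner points. The equivalence `h` lets one case distinction on indices separate diagonal and
off-diagonal entries. -/
theorem knotForm_inner_inner {i j : KnotPoint n} {k l : ℕ} (hi : i.IsInner k) (hj : j.IsInner l)
    (h : i = j ↔ k = l) : knotForm n i j = 2 * (n - max (k : ℤ) l) := by
  rcases lt_trichotomy k l with hkl | rfl | hkl
  · rw [knotForm_of_ne (by rw [ne_eq, h]; omega), knot_diagTerm_inner hi, Picture.offDiagTerm,
      knot_phi_inner_inner_of_gt hj hi hkl, knot_psi_Xp_inner_inner hj hi]
    omega
  · obtain rfl := h.2 rfl
    rw [knotForm_self, knot_diagTerm_inner hi, max_self]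
  · rw [knotForm_of_ne (by rw [ne_eq, h]; omega), knot_diagTerm_inner hi, Picture.offDiagTerm,
      knot_phi_inner_inner_of_lt hj hi hkl, knot_psi_Xp_inner_inner hj hi]
    omega

theorem knotForm_outer_outer {i j : KnotPoint n} {k l : ℕ} (hi : i.IsOuter k) (hj : j.IsOuter l)
    (h : i = j ↔ k = l) : knotForm n i j = 2 * (n - max (k : ℤ) l) - 3 := by
  rcases lt_trichotomy k l with hkl | rfl | hkl
  · rw [knotForm_of_ne (by rw [ne_eq, h]; omega), knot_diagTerm_outer hi, Picture.offDiagTerm,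
      knot_phi_outer_outer_of_gt hj hi hkl, knot_psi_Xp_outer_outer hj hi]
    omega
  · obtain rfl := h.2 rfl
    rw [knotForm_self, knot_diagTerm_outer hi, max_self]
  · rw [knotForm_of_ne (by rw [ne_eq, h]; omega), knot_diagTerm_outer hi, Picture.offDiagTerm,
      knot_phi_outer_outer_of_lt hj hi hkl, knot_psi_Xp_outer_outer hj hi]
    omega

/-- The winding around `X⁺` gives the -2. For `l < k` the exchange of points contributes the extra
1; otherwise inward travel replaces `k` by `l`. -/
theorem knotForm_inner_outer {i j : KnotPoint n} {k l : ℕ} (hi : i.IsInner k) (hj : j.IsOuter l)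
    (h : i ≠ j) : knotForm n i j = 2 * (n - max (k : ℤ) l) - 2 + if l < k then 1 else 0 := by
  rw [knotForm_of_ne h, knot_diagTerm_inner hi, Picture.offDiagTerm, knot_psi_Xp_outer_inner hj hi]
  split_ifs with hkl
  · rw [knot_phi_outer_inner_of_lt hj hi hkl]
    omega
  · rw [knot_phi_outer_inner_of_ge hj hi (by omega)]
    omega

theorem knotForm_outer_inner {i j : KnotPoint n} {k l : ℕ} (hi : i.IsOuter k) (hj : j.IsInner l)
    (h : i ≠ j) : knotForm n i j = 2 * (n - max (k : ℤ) l) - 2 + if k < l then 1 else 0 := by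
  rw [knotForm_of_ne h, knot_diagTerm_outer hi, Picture.offDiagTerm, knot_psi_Xp_inner_outer hj hi]
  split_ifs with hkl
  · rw [knot_phi_inner_outer_of_gt hj hi hkl]
    omega
  · rw [knot_phi_inner_outer_of_le hj hi (by omega)]
    omega

end

end TorusKnotQuiver

/-! ### Block-by-block comparison of the two matrices -/

open TorusKnotQuiver

theorem mainTheorem4 (n : ℕ) (hn : 1 ≤ n) :
    TorusKnotQuiver.QKnot n = TorusKnotQuiver.QClosure n := by
  have hin := KnotPoint.isInner_inner (n := n)
  have hout := KnotPoint.isOuter_outer (n := n)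
  have hlast := KnotPoint.isInner_last (n := n)
  ext i j
  rcases i with (k | k) | w <;> rcases j with (l | l) | w'
  · change knotForm n (.inner k) (.inner l) = tangleForm n (.top k) (.top l) + 2 • 1
    rw [knotForm_inner_inner (hin k) (hin l) (by simp [Fin.ext_iff]), tangleForm_top_top, two_smul]
    omega
  · change knotForm n (.inner k) (.outer l) = tangleForm n (.top k) (.top l) + if l < k then 1 else 0
    rw [knotForm_inner_outer (hin k) (hout l) (by simp), tangleForm_top_top]
    simp only [Fin.lt_def]
    split_ifs <;> omega
  · change knotForm n (.inner k) .last = tangleForm n (.top k) .inactive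
    have := k.2
    rw [knotForm_inner_inner (hin k) hlast (by simp; omega), tangleForm_top_inactive]
    omega
  · change knotForm n (.outer k) (.inner l) = tangleForm n (.top k) (.top l) + if k < l then 1 else 0
    rw [knotForm_outer_inner (hout k) (hin l) (by simp), tangleForm_top_top]
    simp only [Fin.lt_def]
    split_ifs <;> omega
  · change knotForm n (.outer k) (.outer l) = tangleForm n (.top k) (.top l) - 1
    rw [knotForm_outer_outer (hout k) (hout l) (by simp [Fin.ext_iff]), tangleForm_top_top]
    omega
  · change knotForm n (.outer k) .last = tangleForm n (.top k) .inactive - 1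
    rw [knotForm_outer_inner (hout k) hlast (by simp), tangleForm_top_inactive, if_pos k.2]
    omega
  · change knotForm n .last (.inner l) = tangleForm n .inactive (.top l)
    have := l.2
    rw [knotForm_inner_inner hlast (hin l) (by simp; omega), tangleForm_inactive_top]
    omega
  · change knotForm n .last (.outer l) = tangleForm n .inactive (.top l) - 1
    rw [knotForm_inner_outer hlast (hout l) (by simp), tangleForm_inactive_top, if_pos l.2]
    omega
  · change knotForm n .last .last = tangleForm n .inactive .inactive
    rw [knotForm_inner_inner hlast hlast (by simp), tangleForm_inactive_inactive hn]
    omega
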